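/- Words and automata. For a finite alphabet $\Sigma$ and an ordinal $\alpha$, let $\Sigma^\alpha$ be the set of words $(x(\beta))_{\beta<\alpha}$ of length $\alpha$ over $\Sigma$; its subsets are called $\alpha$-languages. An ordinal Büchi automaton over $\Sigma$ is a tuple $(\Sigma,Q,q_0,\Delta,\gamma,F)$ with a finite set $Q$ of states, an initial state $q_0\in Q$, relations $\Delta\subseteq Q\times\Sigma\times Q$ and $\gamma\subseteq P(Q)\times Q$, and a set $F\subseteq Q$ of accepting states. It accepts $\sigma\in\Sigma^\alpha$ if there is a sequence of states $(x(i))_{i\le\alpha}$ such that $x(0)=q_0$, $(x(i),\sigma(i),x(i+1))\in\Delta$ for all $i<\alpha$, $(\mathrm{Inf}(x,i),x(i))\in\gamma$ for all limit ordinals $i\le\alpha$, and $x(\alpha)\in F$, where $\mathrm{Inf}(x,i)=\{q\in Q \mid \forall\mu<i\ \exists\nu<i:\ \mu<\nu,\ x(\nu)=q\}$. An $\alpha$-language is regular if it is the set of all words of length $\alpha$ accepted by some ordinal Büchi automaton. Substitution. Let $n\ge 2$, let $\Sigma,\Gamma$ be finite alphabets, $R\subseteq\Gamma^\omega$, and $L_a\subseteq\Sigma^{\omega^{n-1}}$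 for $a\in\Gamma$. The $\omega^n$-language obtained from $R$ by substituting each letter $a$ by $L_a$ is the set of all infinite concatenations $u_0u_1u_2\cdots\in\Sigma^{\omega^n}$ for which there is $\sigma\in R$ with $u_i\in L_{\sigma(i)}$ for all $i<\omega$. Proposition 4.3. Let $n\ge 2$ be an integer and $\Sigma$ a finite alphabet. An $\omega^n$-language $L\subseteq\Sigma^{\omega^n}$ is regular if and only if there are a finite alphabet $\Gamma$, a regular $\omega$-language $R\subseteq\Gamma^\omega$ and regular $\omega^{n-1}$-languages $L_a\subseteq\Sigma^{\omega^{n-1}}$ $(a\in\Gamma)$ such that $L$ is obtained from $R$ by substituting each letter $a$ by $L_a$. The equivalence remains true if the languages $L_a$ are required in addition to be pairwise disjoint: $L_a\cap L_b=\emptyset$ for all $a\ne b$ in $\Gamma$. -/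

import Mathlib

open scoped Ordinal

/-- Words of length `α` over the alphabet `S`: sequences of letters indexed by the ordinals
below `α`. -/
abbrev OrdWord (S : Type*) (α : Ordinal.{0}) := Set.Iio α → S

/-- Ordinal Büchi automata over the alphabet `S` with set of states `Q`. -/
structure OrdBuchi (S Q : Type*) where
  /-- the initial state -/
  init : Q
  /-- the transition relation for successor steps -/
  succStep : Set (Q × S × Q)
  /-- the transition relation for limit steps -/
  limStep : Set (Set Q × Q)
  /-- the accepting states -/
  accept : Set Q

/-- The set of states that appear cofinally below position `i` in a sequence `x` of length
`α + 1`. -/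
def cofinalStates {Q : Type*} {α : Ordinal.{0}} (x : Set.Iic α → Q) (i : Set.Iic α) : Set Q :=
  {q | ∀ μ < i, ∃ ν < i, μ < ν ∧ x ν = q}

namespace OrdBuchi

variable {S Q : Type*}

/-- `x` is a run of the automaton on the word `w` of length `α`. -/
structure IsRun (M : OrdBuchi S Q) {α : Ordinal.{0}} (w : OrdWord S α)
    (x : Set.Iic α → Q) : Prop where
  zero : x ⟨0, Set.mem_Iic.2 zero_le⟩ = M.init
  succ : ∀ (i : Ordinal.{0}) (hi : i < α),
    (x ⟨i, Set.mem_Iic.2 hi.le⟩, w ⟨i, Set.mem_Iio.2 hi⟩,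
      x ⟨Order.succ i, Set.mem_Iic.2 (Order.succ_le_of_lt hi)⟩) ∈ M.succStep
  lim : ∀ i : Set.Iic α, Order.IsSuccLimit (i : Ordinal.{0}) →
    (cofinalStates x i, x i) ∈ M.limStep

/-- The set of words of length `α` on which the automaton has a successful run. -/
def language (M : OrdBuchi S Q) (α : Ordinal.{0}) : Set (OrdWord S α) :=
  {w | ∃ x : Set.Iic α → Q, M.IsRun w x ∧ x ⟨α, Set.mem_Iic.2 le_rfl⟩ ∈ M.accept}

end OrdBuchi

/-- A set of words of length `α` is regular if it is the set of words of length `α` accepted by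
some ordinal Büchi automaton with finitely many states. -/
def IsRegularOrdLanguage {S : Type*} {α : Ordinal.{0}} (L : Set (OrdWord S α)) : Prop :=
  ∃ (Q : Type) (_ : Finite Q) (M : OrdBuchi S Q), M.language α = L

theorem OrdWord.block_lt {α δ γ : Ordinal.{0}} (h : α * δ = γ) (i : Set.Iio δ)
    (β : Set.Iio α) : α * i + β < γ := by
  have hi := Set.mem_Iio.1 i.2
  have hβ := Set.mem_Iio.1 β.2
  calc α * i + β < α * i + α := by gcongr
    _ = α * Order.succ (i : Ordinal.{0}) := (Ordinal.mul_succ _ _).symm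
    _ ≤ α * δ := by gcongr; exact Order.succ_le_of_lt hi
    _ = γ := h

/-- A word of length `γ = α * δ` is the concatenation of `δ` blocks of length `α`; this is the
block with index `i`. -/
def OrdWord.block {S : Type*} {α δ γ : Ordinal.{0}} (h : α * δ = γ) (w : OrdWord S γ)
    (i : Set.Iio δ) : OrdWord S α :=
  fun β => w ⟨α * i + β, Set.mem_Iio.2 (OrdWord.block_lt h i β)⟩

/-- The language obtained from `R` by substituting, in every word `σ ∈ R`, each letter `a` by the
language `L a`: the concatenations of words `u i ∈ L (σ i)`, `i < δ`, for some `σ ∈ R`. -/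
def ordSubstitution {S Γ : Type*} {α δ γ : Ordinal.{0}} (h : α * δ = γ)
    (R : Set (OrdWord Γ δ)) (L : Γ → Set (OrdWord S α)) : Set (OrdWord S γ) :=
  {w | ∃ σ ∈ R, ∀ i : Set.Iio δ, OrdWord.block h w i ∈ L (σ i)}

theorem omega0_pow_pred_mul {n : ℕ} (hn : 2 ≤ n) : ω ^ (n - 1) * ω = (ω ^ n : Ordinal.{0}) := by
  rw [← pow_succ, Nat.sub_add_cancel (by omega)]

/-! A word of length `ω ^ n` is an `ω`-sequence of blocks of length `ω ^ (n - 1)`. The proof rests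
on two facts about this decomposition.

From regular to substitution: all that an automaton can do on a word `u` is recorded by a finite
object, its type `wordType`, which consists of the triples (first state, states visited before the
end, last state) of its runs. The type of a concatenation of `ω` blocks depends only on the types of
the blocks, through `omegaProd`, because the states cofinal at the end are those visited in
infinitely many blocks. So the types serve as letters, the words of type `τ` as `La τ`, and the
sequences of types with accepting infinite product as `R`. Disjointness is automatic, since a word
has just one type. That `R` is regular follows from Ramsey: every sequence factors into segments
with products `s, e, e, ...`, the infinite product is determined by `s` and `e`, and an automaton
can guess such a factorization. That `La τ` is regular follows by induction on the exponent, from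
closure under substitution.

From substitution to regular: an automaton simulates the inner automata on the blocks and the outer
one between them. It must recognize the ends of blocks. For this it carries the rank of the
position, which is `0` at successors and one more than the largest rank cofinal below at limits; on
a word of length `ω ^ (k + 1)` rank `k` marks the block boundaries and rank `k + 1` the end. -/

open Filter Order

/-- The values that a sequence indexed by all ordinals takes cofinally below `i`. -/
def cofinalValues {Q : Type*} (x : Ordinal.{0} → Q) (i : Ordinal.{0}) : Set Q :=
  {q | ∀ μ < i, ∃ ν < i, μ < ν ∧ x ν = q}

/-- A run of the transition relations `Δ`, `Λ` on the word `w`, from an arbitrary state. The run is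
a sequence indexed by all ordinals, of which only the values up to the length of `w` matter. -/
structure OrdRun {S Q : Type*} (Δ : Set (Q × S × Q)) (Λ : Set (Set Q × Q)) {α : Ordinal.{0}}
    (w : OrdWord S α) (x : Ordinal.{0} → Q) : Prop where
  succ : ∀ (i : Ordinal.{0}) (hi : i < α), (x i, w ⟨i, hi⟩, x (Order.succ i)) ∈ Δ
  lim : ∀ i ≤ α, IsSuccLimit i → (cofinalValues x i, x i) ∈ Λ

theorem ordinal_add_succ (a b : Ordinal.{0}) : a + succ b = succ (a + b) := by
  simp only [succ_eq_add_one, add_assoc]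

/-! ### States that occur cofinally. -/

section CofinalValues

variable {Q Q' : Type*}

theorem cofinalValues_congr {x y : Ordinal.{0} → Q} {i : Ordinal.{0}} (h : ∀ ν < i, x ν = y ν) :
    cofinalValues x i = cofinalValues y i := by
  ext q
  refine forall₂_congr fun μ _ => exists_congr fun ν => and_congr_right fun hν => ?_
  rw [h ν hν]

theorem cofinalValues_add (x : Ordinal.{0} → Q) (a : Ordinal.{0}) {b : Ordinal.{0}} (hb : b ≠ 0) :
    cofinalValues (fun β => x (a + β)) b = cofinalValues x (a + b) := by
  ext q
  constructor
  · intro h μ hμ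
    rcases lt_or_ge μ a with h1 | h1
    · obtain ⟨ν, hν, h0, rfl⟩ := h 0 (pos_iff_ne_zero.2 hb)
      exact ⟨a + ν, by gcongr, h1.trans_le le_self_add, rfl⟩
    · obtain ⟨c, rfl⟩ := exists_add_of_le h1
      obtain ⟨ν, hν, h0, rfl⟩ := h c (lt_of_add_lt_add_left hμ)
      exact ⟨a + ν, by gcongr, by gcongr, rfl⟩
  · intro h μ hμ
    obtain ⟨ν, hν, h0, rfl⟩ := h (a + μ) (by gcongr)
    obtain ⟨c, rfl⟩ := exists_add_of_le (le_self_add.trans h0.le : a ≤ ν)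
    exact ⟨c, lt_of_add_lt_add_left hν, lt_of_add_lt_add_left h0, rfl⟩

/-- Pigeonhole: if no state in the fibre of `q` were cofinal, each would have a bound below `i`, and
the largest of these finitely many bounds would bound the occurrences of `q`. -/
theorem cofinalValues_comp [Finite Q] (f : Q → Q') (x : Ordinal.{0} → Q) {i : Ordinal.{0}}
    (hi : i ≠ 0) : cofinalValues (fun j => f (x j)) i = f '' cofinalValues x i := by
  ext q
  constructor
  · intro h
    by_contra hc
    have h1 : ∀ s, ∃ μ : Set.Iio i, f s = q → ∀ ν < i, μ < ν → x ν ≠ s := by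
      intro s
      by_cases hs : f s = q
      · have : s ∉ cofinalValues x i := fun hm => hc ⟨s, hm, hs⟩
        simp only [cofinalValues, Set.mem_ofPred_eq, not_forall, not_exists, not_and] at this
        obtain ⟨μ, hμ, h2⟩ := this
        exact ⟨⟨μ, hμ⟩, fun _ => h2⟩
      · exact ⟨⟨0, pos_iff_ne_zero.2 hi⟩, fun h => absurd h hs⟩
    choose g hg using h1
    have : Nonempty (Set.Iio i) := ⟨⟨0, pos_iff_ne_zero.2 hi⟩⟩
    obtain ⟨B, hB⟩ := Finite.exists_le g
    obtain ⟨ν, hν, hBν, hq⟩ := h B B.2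
    exact hg (x ν) hq ν hν (lt_of_le_of_lt (hB _) hBν) rfl
  · rintro ⟨s, hs, rfl⟩ μ hμ
    obtain ⟨ν, hν, h0, rfl⟩ := hs μ hμ
    exact ⟨ν, hν, h0, rfl⟩

end CofinalValues

/-! ### Positions in a concatenation of `ω` blocks. -/

section Decomposition

theorem exists_eq_mul_add_of_lt_mul_omega0 {α i : Ordinal.{0}} (hα : α ≠ 0) (hi : i < α * ω) :
    ∃ m : ℕ, ∃ β < α, i = α * m + β := by
  obtain ⟨m, hm⟩ := Ordinal.lt_omega0.1 ((Ordinal.lt_mul_iff_div_lt hα).1 hi)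
  exact ⟨m, i % α, Ordinal.mod_lt _ hα, by rw [← hm, Ordinal.div_add_mod]⟩

/-- The remainder lies in `(0, α]` instead of `[0, α)`, so a boundary counts as the end of the block
before it; this is where a limit condition at the boundary is decided. -/
theorem exists_eq_mul_add_pos_of_lt_mul_omega0 {α i : Ordinal.{0}} (hα : α ≠ 0)
    (hi : i < α * ω) (h0 : i ≠ 0) : ∃ m : ℕ, ∃ β ≤ α, β ≠ 0 ∧ i = α * m + β := by
  obtain ⟨m, β, hβ, rfl⟩ := exists_eq_mul_add_of_lt_mul_omega0 hα hi
  by_cases hb : β = 0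
  · subst hb
    cases m with
    | zero => simp at h0
    | succ m =>
      refine ⟨m, α, le_rfl, hα, ?_⟩
      rw [add_zero, Nat.cast_succ, mul_add_one]
  · exact ⟨m, β, hβ.le, hb, rfl⟩

theorem mul_natCast_add_lt_mul_omega0 {α β : Ordinal.{0}} (hβ : β < α) (m : ℕ) :
    α * m + β < α * ω :=
  OrdWord.block_lt rfl ⟨m, Ordinal.natCast_lt_omega0 m⟩ ⟨β, hβ⟩

theorem mul_natCast_add_self (α : Ordinal.{0}) (m : ℕ) :
    α * m + α = α * ((m + 1 : ℕ) : Ordinal.{0}) := by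
  rw [Nat.cast_succ, mul_add_one]

theorem mul_natCast_add_inj {α β β' : Ordinal.{0}} {m m' : ℕ} (hβ : β < α) (hβ' : β' < α)
    (h : α * m + β = α * m' + β') : m = m' ∧ β = β' := by
  have hα : α ≠ 0 := (pos_of_gt hβ).ne'
  have h1 := congrArg (· / α) h
  have h2 := congrArg (· % α) h
  simp only [Ordinal.mul_add_div _ hα, Ordinal.div_eq_zero_of_lt hβ,
    Ordinal.div_eq_zero_of_lt hβ', add_zero, Nat.cast_inj] at h1
  simp only [Ordinal.mul_add_mod_self, Ordinal.mod_eq_of_lt hβ, Ordinal.mod_eq_of_lt hβ'] at h2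
  exact ⟨h1, h2⟩

/-- The block boundaries are cofinal in `α * ω`, so to occur cofinally is to occur in infinitely
many blocks. -/
theorem cofinalValues_mul_omega0 {Q : Type*} (x : Ordinal.{0} → Q) {α : Ordinal.{0}}
    (hα : α ≠ 0) : cofinalValues x (α * ω) =
      {q | ∃ᶠ m : ℕ in atTop, ∃ β < α, x (α * m + β) = q} := by
  have hpos := pos_iff_ne_zero.2 hα
  ext q
  simp only [Set.mem_ofPred_eq, frequently_atTop]
  constructor
  · intro h a
    obtain ⟨ν, hν, hl, rfl⟩ := h (α * a) (by
      simpa using mul_natCast_add_lt_mul_omega0 hpos a)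
    obtain ⟨m, β, hβ, rfl⟩ := exists_eq_mul_add_of_lt_mul_omega0 hα hν
    refine ⟨m, ?_, β, hβ, rfl⟩
    by_contra hlt
    have h1 : α * ((m + 1 : ℕ) : Ordinal.{0}) ≤ α * a := by
      gcongr; omega
    rw [← mul_natCast_add_self] at h1
    exact absurd (h1.trans_lt hl) (not_lt.2 (by gcongr))
  · intro h μ hμ
    obtain ⟨m, β, hβ, rfl⟩ := exists_eq_mul_add_of_lt_mul_omega0 hα hμ
    obtain ⟨b, hb, β', hβ', rfl⟩ := h (m + 1)
    refine ⟨_, mul_natCast_add_lt_mul_omega0 hβ' b, ?_, rfl⟩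
    calc α * m + β < α * m + α := by gcongr
      _ = α * ((m + 1 : ℕ) : Ordinal.{0}) := mul_natCast_add_self α m
      _ ≤ α * b := by gcongr
      _ ≤ _ := le_self_add

/-- Sequences of length `α + 1` that fit together can be concatenated. -/
theorem exists_concat {Q : Type*} {α : Ordinal.{0}} (hα : α ≠ 0) (X : ℕ → Ordinal.{0} → Q)
    (hX : ∀ m, X m α = X (m + 1) 0) (q : Q) :
    ∃ x : Ordinal.{0} → Q, (∀ m : ℕ, ∀ β ≤ α, x (α * m + β) = X m β) ∧ x (α * ω) = q := by
  classical
  have hpos := pos_iff_ne_zero.2 hα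
  let x : Ordinal.{0} → Q := fun i =>
    if h : i < α * ω then
      X (exists_eq_mul_add_of_lt_mul_omega0 hα h).choose (i % α) else q
  have hx : ∀ m : ℕ, ∀ β < α, x (α * m + β) = X m β := by
    intro m β hβ
    have h := mul_natCast_add_lt_mul_omega0 hβ m
    obtain ⟨β', hβ', he⟩ := (exists_eq_mul_add_of_lt_mul_omega0 hα h).choose_spec
    have := mul_natCast_add_inj hβ hβ' he
    simp only [x, dif_pos h, Ordinal.mul_add_mod_self, Ordinal.mod_eq_of_lt hβ]
    rw [← this.1]
  refine ⟨x, fun m β hβ => ?_, by simp [x]⟩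
  rcases hβ.lt_or_eq with h | rfl
  · exact hx m β h
  · rw [mul_natCast_add_self, hX, ← hx (m + 1) 0 hpos, add_zero]

end Decomposition

/-! ### Runs on words and on their blocks. -/

section OrdRun

variable {S Q : Type*} {Δ : Set (Q × S × Q)} {Λ : Set (Set Q × Q)} {α γ : Ordinal.{0}}

theorem OrdRun.congr {w : OrdWord S α} {x y : Ordinal.{0} → Q} (hx : OrdRun Δ Λ w x)
    (h : ∀ i ≤ α, x i = y i) : OrdRun Δ Λ w y where
  succ i hi := by
    rw [← h i hi.le, ← h _ (succ_le_of_lt hi)]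
    exact hx.succ i hi
  lim i hi hl := by
    rw [← h i hi, ← cofinalValues_congr fun ν hν => h ν (hν.le.trans hi)]
    exact hx.lim i hi hl

theorem isSuccLimit_of_isSuccLimit_add {a b : Ordinal.{0}} (h : IsSuccLimit (a + b))
    (hb : b ≠ 0) : IsSuccLimit b := by
  rcases Ordinal.zero_or_succ_or_isSuccLimit b with h0 | ⟨c, rfl⟩ | h1
  · exact absurd h0 hb
  · rw [ordinal_add_succ] at h
    exact absurd h (not_isSuccLimit_succ _)
  · exact h1

/-- The block of a word of length `α * ω` with a natural number as index. -/
def OrdWord.natBlock (h : α * ω = γ) (w : OrdWord S γ) (m : ℕ) : OrdWord S α :=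
  w.block h ⟨m, Ordinal.natCast_lt_omega0 m⟩

/-- The run on a block includes its right end, so the blocks account for every limit position except
`γ` itself. -/
theorem ordRun_mul_omega0_iff (h : α * ω = γ) (hα : α ≠ 0) (w : OrdWord S γ)
    (x : Ordinal.{0} → Q) :
    OrdRun Δ Λ w x ↔ (∀ m : ℕ, OrdRun Δ Λ (w.natBlock h m) (fun β => x (α * m + β))) ∧
      (cofinalValues x γ, x γ) ∈ Λ := by
  subst h
  constructor
  · intro hx
    refine ⟨fun m => ⟨fun i hi => ?_, fun i hi hl => ?_⟩,
      hx.lim _ le_rfl (Ordinal.isSuccLimit_mul_right (pos_iff_ne_zero.2 hα)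
        Ordinal.isSuccLimit_omega0)⟩
    · have := hx.succ (α * m + i) (mul_natCast_add_lt_mul_omega0 hi m)
      rwa [← ordinal_add_succ] at this
    · rw [cofinalValues_add _ _ (by rintro rfl; simp at hl)]
      refine hx.lim _ ?_ (Ordinal.isSuccLimit_add _ hl)
      calc α * m + i ≤ α * m + α := by gcongr
        _ = α * ((m + 1 : ℕ) : Ordinal.{0}) := mul_natCast_add_self α m
        _ ≤ _ := by gcongr; exact (Ordinal.natCast_lt_omega0 _).le
  · rintro ⟨hb, hl⟩
    refine ⟨fun i hi => ?_, fun i hi hi' => ?_⟩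
    · obtain ⟨m, β, hβ, rfl⟩ := exists_eq_mul_add_of_lt_mul_omega0 hα hi
      have := (hb m).succ β hβ
      rwa [ordinal_add_succ] at this
    · rcases hi.lt_or_eq with hi | rfl
      · obtain ⟨m, β, hβ, h0, rfl⟩ := exists_eq_mul_add_pos_of_lt_mul_omega0 hα hi
          (by rintro rfl; simp at hi')
        have := (hb m).lim β hβ (isSuccLimit_of_isSuccLimit_add hi' h0)
        rwa [cofinalValues_add _ _ h0] at this
      · exact hl

theorem ordRun_omega0_iff (w : OrdWord S ω) (x : Ordinal.{0} → Q) :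
    OrdRun Δ Λ w x ↔
      (∀ m : ℕ, (x m, w ⟨m, Ordinal.natCast_lt_omega0 m⟩, x ((m + 1 : ℕ) : Ordinal.{0})) ∈ Δ) ∧
      ({q | ∃ᶠ m : ℕ in atTop, x m = q}, x ω) ∈ Λ := by
  have hc : cofinalValues x ω = {q | ∃ᶠ m : ℕ in atTop, x m = q} := by
    have := cofinalValues_mul_omega0 x (one_ne_zero (α := Ordinal.{0}))
    simpa [Order.lt_one_iff] using this
  constructor
  · intro h
    refine ⟨fun m => ?_, ?_⟩
    · have := h.succ m (Ordinal.natCast_lt_omega0 m)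
      rwa [succ_eq_add_one, ← Nat.cast_add_one] at this
    · rw [← hc]
      exact h.lim _ le_rfl Ordinal.isSuccLimit_omega0
  · rintro ⟨h1, h2⟩
    refine ⟨fun i hi => ?_, fun i hi hl => ?_⟩
    · obtain ⟨m, rfl⟩ := Ordinal.lt_omega0.1 hi
      have := h1 m
      rwa [Nat.cast_add_one, ← succ_eq_add_one] at this
    · obtain rfl : i = ω := le_antisymm hi (Ordinal.omega0_le_of_isSuccLimit hl)
      rwa [hc]

theorem OrdBuchi.mem_language_iff (M : OrdBuchi S Q) (w : OrdWord S α) :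
    w ∈ M.language α ↔ ∃ x : Ordinal.{0} → Q,
      OrdRun M.succStep M.limStep w x ∧ x 0 = M.init ∧ x α ∈ M.accept := by
  classical
  have key : ∀ (x : Set.Iic α → Q) (y : Ordinal.{0} → Q),
      (∀ i : Set.Iic α, x i = y i) → ∀ i : Set.Iic α, cofinalStates x i = cofinalValues y i := by
    intro x y hxy i
    ext q
    constructor
    · intro h μ hμ
      obtain ⟨ν, hν, h1, h2⟩ := h ⟨μ, hμ.le.trans i.2⟩ hμ
      exact ⟨ν, hν, h1, by rw [← hxy, h2]⟩
    · intro h μ hμ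
      obtain ⟨ν, hν, h1, h2⟩ := h μ hμ
      exact ⟨⟨ν, hν.le.trans i.2⟩, hν, h1, by rw [hxy, h2]⟩
  constructor
  · rintro ⟨x, hx, ha⟩
    let y : Ordinal.{0} → Q := fun i => if h : i ≤ α then x ⟨i, h⟩ else M.init
    have hy : ∀ i (h : i ≤ α), y i = x ⟨i, h⟩ := fun i h => dif_pos h
    refine ⟨y, ⟨fun i hi => ?_, fun i hi hl => ?_⟩, ?_, ?_⟩
    · rw [hy _ hi.le, hy _ (succ_le_of_lt hi)]
      exact hx.succ i hi
    · rw [← key x y (fun j => (hy j j.2).symm) ⟨i, hi⟩, hy i hi]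
      exact hx.lim ⟨i, hi⟩ hl
    · rw [hy 0 zero_le]
      exact hx.zero
    · rwa [hy α le_rfl]
  · rintro ⟨y, hy, h0, ha⟩
    refine ⟨fun i => y i, ⟨h0, fun i hi => hy.succ i hi, fun i hl => ?_⟩, ha⟩
    rw [key _ y (fun _ => rfl)]
    exact hy.lim i i.2 hl

/-- Several initial states do not increase the power of ordinal Büchi automata. -/
theorem isRegularOrdLanguage_of_initialSet {S : Type*} {Q : Type} [Finite Q]
    (Δ : Set (Q × S × Q)) (Λ : Set (Set Q × Q)) (I F : Set Q) (hα : α ≠ 0) :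
    IsRegularOrdLanguage {w : OrdWord S α | ∃ x, OrdRun Δ Λ w x ∧ x 0 ∈ I ∧ x α ∈ F} := by
  classical
  -- The new state `none` stands at position `0` only and steps like any state of `I`. A single
  -- position is never cofinal, so limit steps may ignore `none`.
  let M : OrdBuchi S (Option Q) :=
    { init := none
      succStep := {t | ∃ p q, (t.1 = some p ∨ t.1 = none ∧ p ∈ I) ∧ t.2.2 = some q ∧
        (p, t.2.1, q) ∈ Δ}
      limStep := {t | ∃ q, t.2 = some q ∧ (some ⁻¹' t.1, q) ∈ Λ}
      accept := some '' F }
  have hcof : ∀ (y : Ordinal.{0} → Option Q) (x : Ordinal.{0} → Q) (i : Ordinal.{0}),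
      (∀ j, j ≠ 0 → j < i → y j = some (x j)) →
      some ⁻¹' cofinalValues y i = cofinalValues x i := by
    intro y x i h
    ext q
    constructor
    · intro hq μ hμ
      obtain ⟨ν, hν, h1, h2⟩ := hq μ hμ
      rw [h ν (pos_of_gt h1).ne' hν] at h2
      exact ⟨ν, hν, h1, by simpa using h2⟩
    · intro hq μ hμ
      obtain ⟨ν, hν, h1, h2⟩ := hq μ hμ
      exact ⟨ν, hν, h1, by rw [h ν (pos_of_gt h1).ne' hν, h2]⟩
  refine ⟨Option Q, inferInstance, M, ?_⟩
  ext w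
  rw [M.mem_language_iff]
  constructor
  · rintro ⟨y, hy, h0, ha⟩
    have hsome : ∀ j, j ≠ 0 → j ≤ α → ∃ q, y j = some q := by
      intro j hj hjα
      rcases Ordinal.zero_or_succ_or_isSuccLimit j with h | ⟨c, rfl⟩ | h
      · exact absurd h hj
      · obtain ⟨p, q, _, hq, _⟩ := hy.succ c (lt_of_lt_of_le (lt_succ c) hjα)
        exact ⟨q, hq⟩
      · obtain ⟨q, hq, _⟩ := hy.lim j hjα h
        exact ⟨q, hq⟩
    obtain ⟨p, q, hp, hq, hΔ⟩ := hy.succ 0 (pos_iff_ne_zero.2 hα)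
    have hpI : p ∈ I := by
      rcases hp with hp | hp
      · simp [h0, M] at hp
      · exact hp.2
    let x : Ordinal.{0} → Q := fun i => if i = 0 then p else (y i).getD p
    have hx0 : x 0 = p := by simp [x]
    have hx : ∀ j, j ≠ 0 → j ≤ α → y j = some (x j) := by
      intro j hj hjα
      obtain ⟨q, hq⟩ := hsome j hj hjα
      simp [x, hj, hq]
    refine ⟨x, ⟨fun i hi => ?_, fun i hi hl => ?_⟩, by rwa [hx0], ?_⟩
    · by_cases hi0 : i = 0
      · subst hi0
        rw [hx0]
        have := hx (succ 0) (by simp) (succ_le_of_lt hi)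
        simp only at hq
        rw [hq] at this
        rwa [← Option.some_injective _ this]
      · obtain ⟨p', q', hp', hq', hΔ'⟩ := hy.succ i hi
        simp only at hp' hq' hΔ'
        rw [hx i hi0 hi.le] at hp'
        rw [hx _ (by simp) (succ_le_of_lt hi)] at hq'
        simp only [Option.some.injEq, reduceCtorEq, false_and, or_false] at hp' hq'
        rwa [hp', hq']
    · obtain ⟨q', hq', hΛ⟩ := hy.lim i hi hl
      have hi0 : i ≠ 0 := by rintro rfl; simp at hl
      simp only at hq' hΛ
      rw [hx i hi0 hi] at hq'
      rw [hcof y x i fun j hj hji => hx j hj (hji.le.trans hi)] at hΛ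
      rwa [Option.some_injective _ hq']
    · obtain ⟨q', hq', he⟩ := ha
      rw [hx α hα le_rfl] at he
      rwa [← Option.some_injective _ he]
  · rintro ⟨x, hx, h0, ha⟩
    let y : Ordinal.{0} → Option Q := fun i => if i = 0 then none else some (x i)
    have hy : ∀ j, j ≠ 0 → y j = some (x j) := fun j hj => if_neg hj
    refine ⟨y, ⟨fun i hi => ?_, fun i hi hl => ?_⟩, by simp [y, M], ?_⟩
    · refine ⟨x i, x (succ i), ?_, hy _ (by simp), hx.succ i hi⟩
      by_cases hi0 : i = 0
      · subst hi0
        exact Or.inr ⟨by simp [y], h0⟩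
      · exact Or.inl (hy i hi0)
    · refine ⟨x i, hy i (by rintro rfl; simp at hl), ?_⟩
      simp only
      rw [hcof y x i fun j hj _ => hy j hj]
      exact hx.lim i hi hl
    · rw [hy α hα]
      exact ⟨_, ha, rfl⟩

end OrdRun

/-! ### Automata on `ω`-words. -/

section OmegaAutomata

theorem exists_omega0_seq {Q : Type*} (y : ℕ → Q) (q : Q) :
    ∃ x : Ordinal.{0} → Q, (∀ m : ℕ, x m = y m) ∧ x ω = q := by
  obtain ⟨x, h1, h2⟩ := exists_concat (one_ne_zero (α := Ordinal.{0}))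
    (fun m i => if i = 0 then y m else y (m + 1)) (by simp) q
  refine ⟨x, fun m => ?_, by simpa using h2⟩
  simpa using h1 m 0 zero_le

theorem OrdBuchi.mem_language_omega0_iff {S Q : Type*} (M : OrdBuchi S Q) (w : OrdWord S ω) :
    w ∈ M.language ω ↔ ∃ (y : ℕ → Q) (q : Q), y 0 = M.init ∧
      (∀ m, (y m, w ⟨m, Ordinal.natCast_lt_omega0 m⟩, y (m + 1)) ∈ M.succStep) ∧
      ({q | ∃ᶠ m in atTop, y m = q}, q) ∈ M.limStep ∧ q ∈ M.accept := by
  rw [M.mem_language_iff]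
  constructor
  · rintro ⟨x, hx, h0, ha⟩
    rw [ordRun_omega0_iff] at hx
    exact ⟨fun m => x m, x ω, by simpa using h0, hx.1, hx.2, ha⟩
  · rintro ⟨y, q, h0, h1, h2, ha⟩
    obtain ⟨x, hx, rfl⟩ := exists_omega0_seq y q
    refine ⟨x, (ordRun_omega0_iff _ _).2 ⟨fun m => ?_, ?_⟩, ?_, ha⟩
    · rw [hx, hx]
      exact h1 m
    · simpa only [hx] using h2
    · rw [← h0, ← hx, Nat.cast_zero]

/-- Nondeterministic Muller automata recognize regular `ω`-languages. -/
theorem isRegularOrdLanguage_muller {S : Type*} {Q : Type} [Finite Q] (I : Set Q)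
    (Δ : Set (Q × S × Q)) (A : Set (Set Q)) :
    IsRegularOrdLanguage {w : OrdWord S ω | ∃ y : ℕ → Q, y 0 ∈ I ∧
      (∀ m, (y m, w ⟨m, Ordinal.natCast_lt_omega0 m⟩, y (m + 1)) ∈ Δ) ∧
      {q | ∃ᶠ m in atTop, y m = q} ∈ A} := by
  convert isRegularOrdLanguage_of_initialSet Δ {t | t.1 ∈ A} I Set.univ
    Ordinal.omega0_ne_zero using 1
  ext w
  constructor
  · rintro ⟨y, h0, h1, h2⟩
    obtain ⟨x, hx, -⟩ := exists_omega0_seq y (y 0)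
    refine ⟨x, (ordRun_omega0_iff _ _).2 ⟨fun m => ?_, ?_⟩, ?_, trivial⟩
    · rw [hx, hx]
      exact h1 m
    · simpa only [hx, Set.mem_ofPred_eq] using h2
    · rwa [← Nat.cast_zero, hx]
  · rintro ⟨x, hx, h0, -⟩
    rw [ordRun_omega0_iff] at hx
    exact ⟨fun m => x m, by simpa using h0, hx.1, hx.2⟩

theorem frequently_exists_iff_of_finite {ι X : Type*} [Finite ι] {l : Filter X}
    {p : ι → X → Prop} : (∃ᶠ x in l, ∃ i, p i x) ↔ ∃ i, ∃ᶠ x in l, p i x := by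
  simp only [Filter.Frequently, not_exists, eventually_all, not_forall]

end OmegaAutomata

/-! ### Ramsey factorization and finite products; the multiplication need not be associative. -/

section Ramsey

variable {T : Type*}

theorem Ultrafilter.exists_eventually_eq {X : Type*} [Finite T] (U : Ultrafilter X) (g : X → T) :
    ∃ t, ∀ᶠ x in U, g x = t := by
  by_contra h
  simp only [not_exists, ← Ultrafilter.eventually_not] at h
  obtain ⟨x, hx⟩ := (eventually_all.2 h).exists
  exact hx (g x) rfl

/-- Ramsey factorization of an infinite sequence. -/
theorem exists_factorization [Finite T] (P : ℕ → ℕ → T) :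
    ∃ (j : ℕ → ℕ) (s e : T), StrictMono j ∧ j 0 = 0 ∧ P (j 0) (j 1) = s ∧
      ∀ m, P (j (m + 1)) (j (m + 2)) = e := by
  let U := hyperfilter ℕ
  have hU : ∀ a, ∀ᶠ k in (U : Filter ℕ), a < k := fun a =>
    (Nat.hyperfilter_le_atTop) (eventually_gt_atTop a)
  -- `g i` is the value of `P i k` for almost all `k` with respect to a nonprincipal ultrafilter,
  -- and `e` is the value of `g` almost everywhere. Each jump from `i` can then go to some `k > i`
  -- with `P i k = g i` and `g k = e`, so every jump after the first has value `e`.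
  choose g hg using fun i => Ultrafilter.exists_eventually_eq U (P i)
  obtain ⟨e, he⟩ := Ultrafilter.exists_eventually_eq U g
  have hstep : ∀ i, ∃ k, i < k ∧ P i k = g i ∧ g k = e := fun i =>
    ((hU i).and ((hg i).and he)).exists
  choose f h1 h2 h3 using hstep
  have hj : ∀ m, (f^[m + 1]) 0 = f (f^[m] 0) := fun m => Function.iterate_succ_apply' f m 0
  refine ⟨fun m => f^[m] 0, g 0, e, strictMono_nat_of_lt_succ fun m => ?_, rfl, h2 0, fun m => ?_⟩
  · simp only [hj]
    exact h1 _
  · simp only [hj (m + 1), h2]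
    rw [hj, h3]

variable [Mul T] [One T]

/-- The product `σ a * σ (a + 1) * ⋯ * σ (b - 1)`, for `a ≤ b`. -/
def segmentProd (σ : ℕ → T) (a : ℕ) : ℕ → T
  | 0 => 1
  | b + 1 => if a ≤ b then segmentProd σ a b * σ b else 1

theorem segmentProd_self (σ : ℕ → T) (a : ℕ) : segmentProd σ a a = 1 := by
  cases a <;> simp [segmentProd]

theorem segmentProd_succ (σ : ℕ → T) {a b : ℕ} (h : a ≤ b) :
    segmentProd σ a (b + 1) = segmentProd σ a b * σ b := by
  simp [segmentProd, h]

end Ramsey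

/-! ### Recognizing infinite products by guessing factorizations. -/

section FactorizationAutomaton

variable {T : Type} [Mul T] [One T]

theorem exists_mem_Ico_of_strictMono {j : ℕ → ℕ} (hj : StrictMono j) (h0 : j 0 = 0) (i : ℕ) :
    ∃ m, j m ≤ i ∧ i < j (m + 1) := by
  induction i with
  | zero => exact ⟨0, h0.le, by have := hj (Nat.lt_add_one 0); omega⟩
  | succ i ih =>
    obtain ⟨m, h1, h2⟩ := ih
    rcases (Nat.succ_le_of_lt h2).lt_or_eq with h | h
    · exact ⟨m, by omega, h⟩
    · exact ⟨m + 1, h.ge, by rw [Nat.succ_eq_add_one] at h; rw [h]; exact hj (Nat.lt_succ_self _)⟩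

theorem eq_of_mem_Ico_of_strictMono {j : ℕ → ℕ} (hj : StrictMono j) {i m m' : ℕ}
    (h1 : j m ≤ i) (h2 : i < j (m + 1)) (h3 : j m' ≤ i) (h4 : i < j (m' + 1)) : m = m' := by
  have := hj.lt_iff_lt.1 (h1.trans_lt h4)
  have := hj.lt_iff_lt.1 (h3.trans_lt h2)
  omega

/-- The states of the automaton that guesses factorizations: the product that the present factor
is to have, the product that the later factors are to have, the product of the letters of the
present factor read so far, and a mark at the beginning of each factor. -/
abbrev FactorState (T : Type) := T × T × T × Bool

/-- The transitions of the automaton that guesses factorizations. -/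
def factorStep {S : Type*} (f : S → T) : Set (FactorState T × S × FactorState T) :=
  {t | t.2.2 = (t.1.1, t.1.2.1, t.1.2.2.1 * f t.2.1, false) ∨
    t.1.2.2.1 * f t.2.1 = t.1.1 ∧ t.2.2 = (t.1.2.1, t.1.2.1, 1, true)}

/-- The marked positions of a run are the cut points of the factorization. Infinitely many marks are
needed for the cut points to form an infinite sequence. -/
theorem exists_factor_run_iff [Finite T] {S : Type*} (f : S → T) (w : ℕ → S) (s e : T) :
    (∃ y : ℕ → FactorState T, y 0 = (s, e, 1, true) ∧
      (∀ m, (y m, w m, y (m + 1)) ∈ factorStep f) ∧ ∃ᶠ m in atTop, (y m).2.2.2 = true) ↔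
    ∃ j : ℕ → ℕ, StrictMono j ∧ j 0 = 0 ∧
      segmentProd (fun i => f (w i)) (j 0) (j 1) = s ∧
      ∀ m, segmentProd (fun i => f (w i)) (j (m + 1)) (j (m + 2)) = e := by
  classical
  constructor
  · rintro ⟨y, h0, hs, hf⟩
    have hinf : {m | (y m).2.2.2 = true}.Infinite := Nat.frequently_atTop_iff_infinite.1 hf
    let j := Nat.nth (fun m => (y m).2.2.2 = true)
    have hj : StrictMono j := Nat.nth_strictMono hinf
    have hj0 : j 0 = 0 := Nat.nth_zero_of_zero (by simp [h0])
    have hmark : ∀ m, (y (j m)).2.2.2 = true := fun m => Nat.nth_mem_of_infinite hinf m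
    have he : ∀ i, (y i).2.1 = e := by
      intro i
      induction i with
      | zero => simp [h0]
      | succ i ih =>
        rcases hs i with h | ⟨-, h⟩ <;> simp only at h <;> rw [h] <;> exact ih
    have hmk : ∀ i, (y (i + 1)).2.2.2 = true →
        y (i + 1) = (e, e, 1, true) ∧ (y i).2.2.1 * f (w i) = (y i).1 := by
      intro i hi
      rcases hs i with h | ⟨h', h⟩
      · simp only at h
        rw [h] at hi
        simp at hi
      · simp only at h h'
        rw [h, he]
        exact ⟨rfl, h'⟩
    have hstart : ∀ m, (y (j m)).2.2.1 = 1 := by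
      intro m
      rcases Nat.eq_zero_or_pos (j m) with h | h
      · rw [h, h0]
      · obtain ⟨i, hi⟩ := Nat.exists_eq_add_of_lt h
        have := hmark m
        rw [hi, zero_add] at this ⊢
        rw [(hmk i this).1]
    have hseg : ∀ m i, j m ≤ i → i < j (m + 1) →
        (y i).2.2.1 = segmentProd (fun i => f (w i)) (j m) i ∧ (y i).1 = (y (j m)).1 := by
      intro m i hi
      induction i, hi using Nat.le_induction with
      | base => intro _; exact ⟨by rw [hstart, segmentProd_self], rfl⟩
      | succ i hi ih =>
        intro hlt
        obtain ⟨ih1, ih2⟩ := ih (by omega)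
        have hnm : ¬ (y (i + 1)).2.2.2 = true := by
          intro hm
          obtain ⟨m', hm'⟩ := Nat.exists_lt_card_nth_eq (p := fun m => (y m).2.2.2 = true) hm
          have h1 : j m' = i + 1 := hm'.2
          rw [← h1] at hlt
          have h2 : j m < j m' := by omega
          have := hj.lt_iff_lt.1 hlt
          have := hj.lt_iff_lt.1 h2
          omega
        rcases hs i with h | ⟨-, h⟩
        · simp only at h
          rw [h, segmentProd_succ _ hi]
          exact ⟨by rw [← ih1], ih2⟩
        · simp only at h
          rw [h] at hnm
          simp at hnm
    have hprod : ∀ m, segmentProd (fun i => f (w i)) (j m) (j (m + 1)) = (y (j m)).1 := by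
      intro m
      have hlt : j m < j (m + 1) := hj (Nat.lt_succ_self m)
      obtain ⟨i, hi⟩ := Nat.exists_eq_add_of_lt (Nat.zero_lt_of_lt hlt)
      rw [zero_add] at hi
      obtain ⟨h1, h2⟩ := hseg m i (by omega) (by omega)
      have := hmark (m + 1)
      rw [hi] at this ⊢
      rw [segmentProd_succ _ (by omega), ← h1, ← h2]
      exact (hmk i this).2
    refine ⟨j, hj, hj0, ?_, fun m => ?_⟩
    · rw [hprod, hj0, h0]
    · rw [hprod]
      have hlt : j m < j (m + 1) := hj (Nat.lt_succ_self m)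
      obtain ⟨i, hi⟩ := Nat.exists_eq_add_of_lt (Nat.zero_lt_of_lt hlt)
      rw [zero_add] at hi
      have := hmark (m + 1)
      rw [hi] at this ⊢
      rw [(hmk i this).1]
  · rintro ⟨j, hj, hj0, h1, h2⟩
    choose m hm1 hm2 using exists_mem_Ico_of_strictMono hj hj0
    have hm : ∀ i n, j n ≤ i → i < j (n + 1) → m i = n := fun i n h h' =>
      eq_of_mem_Ico_of_strictMono hj (hm1 i) (hm2 i) h h'
    let c : ℕ → T := fun n => if n = 0 then s else e
    have hc : ∀ n, segmentProd (fun i => f (w i)) (j n) (j (n + 1)) = c n := by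
      intro n
      cases n with
      | zero => exact h1
      | succ n => exact h2 n
    have hmj : ∀ n, m (j n) = n := fun n => hm _ _ le_rfl (hj (Nat.lt_succ_self n))
    refine ⟨fun i => (c (m i), e, segmentProd (fun i => f (w i)) (j (m i)) i,
      decide (j (m i) = i)), ?_, fun i => ?_, ?_⟩
    · have : m 0 = 0 := by simpa [hj0] using hmj 0
      simp [this, hj0, c, segmentProd]
    · rcases (Nat.succ_le_of_lt (hm2 i)).lt_or_eq with h | h
      · left
        have hmi : m (i + 1) = m i := hm _ _ ((hm1 i).trans (Nat.le_succ i)) h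
        have hne : j (m i) ≠ i + 1 := by have := hm1 i; omega
        simp only [hmi, hne, decide_false, segmentProd_succ _ (hm1 i)]
      · right
        rw [Nat.succ_eq_add_one] at h
        have hmi : m (i + 1) = m i + 1 := by rw [h]; exact hmj _
        refine ⟨?_, ?_⟩
        · simp only
          rw [← hc, ← h, segmentProd_succ _ (hm1 i)]
        · simp [hmi, ← h, segmentProd_self, c]
    · rw [frequently_atTop]
      intro a
      exact ⟨j a, hj.le_apply, by simp [hmj]⟩

/-- An `ω`-language is regular if it is defined through an infinite product in a finite set which
is compatible with factorizations. -/
theorem isRegularOrdLanguage_of_infiniteProd [Finite T] {S X : Type*} (f : S → T)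
    (Pi : (ℕ → T) → X)
    (hPi : ∀ (σ : ℕ → T) (j : ℕ → ℕ), StrictMono j → j 0 = 0 →
      Pi (fun m => segmentProd σ (j m) (j (m + 1))) = Pi σ) (A : Set X) :
    IsRegularOrdLanguage {w : OrdWord S ω |
      Pi (fun m : ℕ => f (w ⟨m, Ordinal.natCast_lt_omega0 m⟩)) ∈ A} := by
  let V : T → T → ℕ → T := fun s e m => if m = 0 then s else e
  convert isRegularOrdLanguage_muller
    {q : FactorState T | Pi (V q.1 q.2.1) ∈ A ∧ q.2.2 = (1, true)}
    -- There are finitely many states, so infinitely many marks occur exactly when some marked state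
    -- recurs.
    (factorStep f) {C | ∃ q ∈ C, q.2.2.2 = true} using 1
  ext w
  have key : ∀ s e, (∃ j : ℕ → ℕ, StrictMono j ∧ j 0 = 0 ∧
      segmentProd (fun i : ℕ => f (w ⟨i, Ordinal.natCast_lt_omega0 i⟩)) (j 0) (j 1) = s ∧
      ∀ m, segmentProd (fun i : ℕ => f (w ⟨i, Ordinal.natCast_lt_omega0 i⟩))
        (j (m + 1)) (j (m + 2)) = e) →
      Pi (fun m : ℕ => f (w ⟨m, Ordinal.natCast_lt_omega0 m⟩)) = Pi (V s e) := by
    rintro s e ⟨j, hj, hj0, h1, h2⟩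
    rw [← hPi _ j hj hj0]
    congr 1
    funext m
    cases m with
    | zero => exact h1
    | succ m => exact h2 m
  constructor
  · intro hw
    obtain ⟨j, s, e, hf⟩ := exists_factorization
      (segmentProd (fun i : ℕ => f (w ⟨i, Ordinal.natCast_lt_omega0 i⟩)))
    obtain ⟨y, h0, h1, h2⟩ := (exists_factor_run_iff f
      (fun i : ℕ => w ⟨i, Ordinal.natCast_lt_omega0 i⟩) s e).2 ⟨j, hf⟩
    refine ⟨y, ?_, h1, ?_⟩
    · rw [h0]
      refine ⟨?_, rfl⟩
      rw [← key s e ⟨j, hf⟩]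
      exact hw
    · have : ∃ᶠ m in atTop, ∃ q : FactorState T, q.2.2.2 = true ∧ y m = q :=
        h2.mono fun m hm => ⟨_, hm, rfl⟩
      obtain ⟨q, hq⟩ := frequently_exists_iff_of_finite.1 this
      exact ⟨q, hq.mono fun m hm => hm.2, hq.exists.choose_spec.1⟩
  · rintro ⟨y, ⟨hA, h0⟩, h1, q, hq, hmark⟩
    have hf : ∃ᶠ m in atTop, (y m).2.2.2 = true := by
      refine Frequently.mono hq fun m hm => ?_
      rw [hm, hmark]
    have hj := (exists_factor_run_iff f (fun i : ℕ => w ⟨i, Ordinal.natCast_lt_omega0 i⟩)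
      (y 0).1 (y 0).2.1).1 ⟨y, by rw [← h0], h1, hf⟩
    change Pi _ ∈ A
    rw [key _ _ hj]
    exact hA

end FactorizationAutomaton

/-- Run types: sets of triples that consist of the first state of a run, the set of the states at
the positions before the last one, and the last state. -/
def RunType (Q : Type) : Type := Set (Q × Set Q × Q)

/-! ### The finite algebra of run types. -/

namespace RunType

variable {Q : Type}

instance [Finite Q] : Finite (RunType Q) := inferInstanceAs (Finite (Set (Q × Set Q × Q)))

instance : Membership (Q × Set Q × Q) (RunType Q) :=
  inferInstanceAs (Membership (Q × Set Q × Q) (Set (Q × Set Q × Q)))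

theorem ext {a b : RunType Q} (h : ∀ t, t ∈ a ↔ t ∈ b) : a = b := Set.ext h

instance : One (RunType Q) := ⟨{t : Q × Set Q × Q | t.1 = t.2.2 ∧ t.2.1 = ∅}⟩

instance : Mul (RunType Q) :=
  ⟨fun a b => {t : Q × Set Q × Q | ∃ q U V, (t.1, U, q) ∈ a ∧ (q, V, t.2.2) ∈ b ∧ t.2.1 = U ∪ V}⟩

theorem mem_one_iff {t : Q × Set Q × Q} : t ∈ (1 : RunType Q) ↔ t.1 = t.2.2 ∧ t.2.1 = ∅ := Iff.rfl

theorem mem_mul_iff {a b : RunType Q} {t : Q × Set Q × Q} :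
    t ∈ a * b ↔ ∃ q U V, (t.1, U, q) ∈ a ∧ (q, V, t.2.2) ∈ b ∧ t.2.1 = U ∪ V := Iff.rfl

/-- Unfolds a product into a chain of intermediate states and visited sets, so that regrouping
factors becomes regrouping chains. -/
theorem mem_segmentProd_iff (σ : ℕ → RunType Q) {a b : ℕ} (h : a ≤ b) (t : Q × Set Q × Q) :
    t ∈ segmentProd σ a b ↔ ∃ (s : ℕ → Q) (V : ℕ → Set Q), s a = t.1 ∧ s b = t.2.2 ∧
      (∀ i, a ≤ i → i < b → (s i, V i, s (i + 1)) ∈ σ i) ∧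
      t.2.1 = {q | ∃ i, a ≤ i ∧ i < b ∧ q ∈ V i} := by
  classical
  induction b, h using Nat.le_induction generalizing t with
  | base =>
    rw [segmentProd_self, mem_one_iff]
    constructor
    · rintro ⟨h1, h2⟩
      refine ⟨fun _ => t.1, fun _ => ∅, rfl, h1, fun i _ _ => by omega, by simp [h2]⟩
    · rintro ⟨s, V, h1, h2, -, h3⟩
      refine ⟨h1.symm.trans h2, h3.trans ?_⟩
      ext q
      simp only [Set.mem_ofPred_eq, Set.mem_empty_iff_false, iff_false]
      rintro ⟨i, hi, hi', -⟩
      omega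
  | succ b hab ih =>
    rw [segmentProd_succ _ hab, mem_mul_iff]
    constructor
    · rintro ⟨q, U, W, h1, h2, h3⟩
      obtain ⟨s, V, hs1, hs2, hs3, hU⟩ := (ih _).1 h1
      simp only at hs1 hs2 hU
      refine ⟨fun i => if i ≤ b then s i else t.2.2, fun i => if i < b then V i else W,
        by simp [hab, hs1], by simp, fun i hi hi' => ?_, ?_⟩
      · rcases (Nat.lt_succ_iff.1 hi').lt_or_eq with hlt | rfl
        · simpa [hlt, hlt.le, Nat.succ_le_of_lt hlt] using hs3 i hi hlt
        · simpa [hs2] using h2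
      · rw [h3, hU]
        ext p
        simp only [Set.mem_union, Set.mem_ofPred_eq]
        constructor
        · rintro (⟨i, hi, hi', hp⟩ | hp)
          · exact ⟨i, hi, by omega, by simpa [hi'] using hp⟩
          · exact ⟨b, hab, by omega, by simpa using hp⟩
        · rintro ⟨i, hi, hi', hp⟩
          by_cases hlt : i < b
          · exact Or.inl ⟨i, hi, hlt, by simpa [hlt] using hp⟩
          · exact Or.inr (by simpa [hlt] using hp)
    · rintro ⟨s, V, hs1, hs2, hs3, hU⟩
      refine ⟨s b, {q | ∃ i, a ≤ i ∧ i < b ∧ q ∈ V i}, V b, (ih _).2 ⟨s, V, hs1, rfl,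
        fun i hi hi' => hs3 i hi (by omega), rfl⟩, hs2 ▸ hs3 b hab (by omega), ?_⟩
      rw [hU]
      ext p
      simp only [Set.mem_union, Set.mem_ofPred_eq]
      constructor
      · rintro ⟨i, hi, hi', hp⟩
        rcases (Nat.lt_succ_iff.1 hi').lt_or_eq with hlt | rfl
        · exact Or.inl ⟨i, hi, hlt, hp⟩
        · exact Or.inr hp
      · rintro (⟨i, hi, hi', hp⟩ | hp)
        · exact ⟨i, hi, by omega, hp⟩
        · exact ⟨b, hab, by omega, hp⟩

/-- The infinite product of run types, for the limit transition relation `Λ`. -/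
def omegaProd (Λ : Set (Set Q × Q)) (σ : ℕ → RunType Q) : RunType Q :=
  {t : Q × Set Q × Q | ∃ (s : ℕ → Q) (V : ℕ → Set Q), s 0 = t.1 ∧
    (∀ m, (s m, V m, s (m + 1)) ∈ σ m) ∧ t.2.1 = {q | ∃ m, q ∈ V m} ∧
    ({q | ∃ᶠ m in atTop, q ∈ V m}, t.2.2) ∈ Λ}

theorem mem_omegaProd_iff {Λ : Set (Set Q × Q)} {σ : ℕ → RunType Q} {t : Q × Set Q × Q} :
    t ∈ omegaProd Λ σ ↔ ∃ (s : ℕ → Q) (V : ℕ → Set Q), s 0 = t.1 ∧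
      (∀ m, (s m, V m, s (m + 1)) ∈ σ m) ∧ t.2.1 = {q | ∃ m, q ∈ V m} ∧
      ({q | ∃ᶠ m in atTop, q ∈ V m}, t.2.2) ∈ Λ := Iff.rfl

/-- The segments are finite intervals that cover `ℕ`, so a state lies in infinitely many `V i`
exactly when it lies in infinitely many unions of `V i` over segments. -/
theorem omegaProd_segmentProd (Λ : Set (Set Q × Q)) (σ : ℕ → RunType Q) (j : ℕ → ℕ)
    (hj : StrictMono j) (h0 : j 0 = 0) :
    omegaProd Λ (fun m => segmentProd σ (j m) (j (m + 1))) = omegaProd Λ σ := by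
  have hlt : ∀ m, j m < j (m + 1) := fun m => hj (Nat.lt_succ_self m)
  have hunion : ∀ V : ℕ → Set Q,
      {q | ∃ m i, j m ≤ i ∧ i < j (m + 1) ∧ q ∈ V i} = {q | ∃ i, q ∈ V i} := by
    intro V
    ext q
    constructor
    · rintro ⟨m, i, -, -, h⟩
      exact ⟨i, h⟩
    · rintro ⟨i, h⟩
      obtain ⟨m, h1, h2⟩ := exists_mem_Ico_of_strictMono hj h0 i
      exact ⟨m, i, h1, h2, h⟩
  have hfreq : ∀ V : ℕ → Set Q,
      {q | ∃ᶠ m in atTop, ∃ i, j m ≤ i ∧ i < j (m + 1) ∧ q ∈ V i} =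
        {q | ∃ᶠ i in atTop, q ∈ V i} := by
    intro V
    ext q
    simp only [Set.mem_ofPred_eq, frequently_atTop]
    constructor
    · intro h a
      obtain ⟨m, hm, i, hi, -, hq⟩ := h a
      exact ⟨i, (hm.trans hj.le_apply).trans hi, hq⟩
    · intro h a
      obtain ⟨i, hi, hq⟩ := h (j a)
      obtain ⟨m, h1, h2⟩ := exists_mem_Ico_of_strictMono hj h0 i
      exact ⟨m, Nat.lt_succ_iff.1 (hj.lt_iff_lt.1 (hi.trans_lt h2)), i, h1, h2, hq⟩
  apply RunType.ext
  intro t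
  simp only [mem_omegaProd_iff]
  constructor
  · rintro ⟨s, V, hs0, hs, hV, hΛ⟩
    choose s' V' h1 h2 h3 h4 using fun m =>
      (mem_segmentProd_iff σ (hlt m).le _).1 (hs m)
    simp only at h1 h2 h4
    -- `n i` is the index of the segment that contains `i`; the chains chosen for the segments are
    -- read along `n` and agree at the cut points.
    choose n hn1 hn2 using exists_mem_Ico_of_strictMono hj h0
    have hn : ∀ i m, j m ≤ i → i < j (m + 1) → n i = m := fun i m h h' =>
      eq_of_mem_Ico_of_strictMono hj (hn1 i) (hn2 i) h h'
    have hV' : ∀ m, V m = {q | ∃ i, j m ≤ i ∧ i < j (m + 1) ∧ q ∈ V' (n i) i} := by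
      intro m
      rw [h4 m]
      ext q
      refine exists_congr fun i => and_congr_right fun hi => and_congr_right fun hi' => ?_
      rw [hn i m hi hi']
    refine ⟨fun i => s' (n i) i, fun i => V' (n i) i, ?_, fun i => ?_, ?_, ?_⟩
    · have hn0 : n 0 = 0 := hn 0 0 h0.le (by have := hlt 0; omega)
      have := h1 0
      rw [h0] at this
      simp only [hn0, this, hs0]
    · simp only
      have := h3 (n i) i (hn1 i) (hn2 i)
      rcases (Nat.succ_le_of_lt (hn2 i)).lt_or_eq with h | h
      · rwa [hn (i + 1) (n i) ((hn1 i).trans (Nat.le_succ i)) h]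
      · rw [Nat.succ_eq_add_one] at h
        have hni : n (i + 1) = n i + 1 := hn _ _ h.ge (h ▸ hlt _)
        have e1 := h1 (n i + 1)
        have e2 := h2 (n i)
        rw [← h] at e1 e2
        rw [hni, e1, ← e2]
        exact this
    · rw [hV, ← hunion fun i => V' (n i) i]
      simp only [hV', Set.mem_ofPred_eq]
    · rw [← hfreq]
      simpa only [hV', Set.mem_ofPred_eq] using hΛ
  · rintro ⟨s, V, hs0, hs, hV, hΛ⟩
    refine ⟨fun m => s (j m), fun m => {q | ∃ i, j m ≤ i ∧ i < j (m + 1) ∧ q ∈ V i},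
      by simpa only [h0] using hs0, fun m => ?_, ?_, ?_⟩
    · exact (mem_segmentProd_iff σ (hlt m).le _).2 ⟨s, V, rfl, rfl, fun i _ _ => hs i, rfl⟩
    · rw [hV, ← hunion]
      rfl
    · have := hfreq V
      simp only [Set.mem_ofPred_eq] at this ⊢
      rwa [this]

end RunType

/-! ### Types of words. -/

section WordType

variable {S : Type*} {Q : Type} (Δ : Set (Q × S × Q)) (Λ : Set (Set Q × Q)) {α γ : Ordinal.{0}}

/-- The type of a word: the information on all runs on the word that matters for the runs on longer
words. -/
def wordType (u : OrdWord S α) : RunType Q :=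
  {t : Q × Set Q × Q | ∃ x, OrdRun Δ Λ u x ∧ x 0 = t.1 ∧ {q | ∃ i < α, x i = q} = t.2.1 ∧
    x α = t.2.2}

theorem mem_wordType_iff {u : OrdWord S α} {t : Q × Set Q × Q} :
    t ∈ wordType Δ Λ u ↔ ∃ x, OrdRun Δ Λ u x ∧ x 0 = t.1 ∧ {q | ∃ i < α, x i = q} = t.2.1 ∧
      x α = t.2.2 := Iff.rfl

theorem OrdBuchi.mem_language_iff_wordType (M : OrdBuchi S Q) (w : OrdWord S α) :
    w ∈ M.language α ↔ ∃ t ∈ wordType M.succStep M.limStep w, t.1 = M.init ∧ t.2.2 ∈ M.accept := by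
  rw [M.mem_language_iff]
  constructor
  · rintro ⟨x, hx, h0, ha⟩
    exact ⟨(x 0, {q | ∃ i < α, x i = q}, x α), ⟨x, hx, rfl, rfl, rfl⟩, h0, ha⟩
  · rintro ⟨t, ⟨x, hx, h1, h2, h3⟩, h0, ha⟩
    exact ⟨x, hx, h1.trans h0, h3 ▸ ha⟩

/-- Runs restrict to blocks, and block runs with matching ends glue by `exists_concat`. Since
visited sets leave out the last position, those of the blocks tile the word, and the cofinal states
are those in infinitely many of them. -/
theorem wordType_mul_omega0 (h : α * ω = γ) (hα : α ≠ 0) (w : OrdWord S γ) :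
    wordType Δ Λ w = RunType.omegaProd Λ (fun m => wordType Δ Λ (w.natBlock h m)) := by
  subst h
  apply RunType.ext
  intro t
  rw [mem_wordType_iff, RunType.mem_omegaProd_iff]
  have himage : ∀ x : Ordinal.{0} → Q,
      {q | ∃ i < α * ω, x i = q} = {q | ∃ m : ℕ, ∃ β < α, x (α * m + β) = q} := by
    intro x
    ext q
    constructor
    · rintro ⟨i, hi, hq⟩
      obtain ⟨m, β, hβ, rfl⟩ := exists_eq_mul_add_of_lt_mul_omega0 hα hi
      exact ⟨m, β, hβ, hq⟩
    · rintro ⟨m, β, hβ, hq⟩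
      exact ⟨_, mul_natCast_add_lt_mul_omega0 hβ m, hq⟩
  constructor
  · rintro ⟨x, hx, h0, hV, h1⟩
    rw [ordRun_mul_omega0_iff rfl hα] at hx
    refine ⟨fun m => x (α * m), fun m => {q | ∃ β < α, x (α * m + β) = q}, by simpa using h0,
      fun m => ⟨_, hx.1 m, by simp, rfl, by simp [mul_natCast_add_self]⟩, ?_, ?_⟩
    · rw [← hV, himage]
      rfl
    · rw [← h1]
      simpa only [cofinalValues_mul_omega0 x hα, Set.mem_ofPred_eq] using hx.2
  · rintro ⟨s, V, h0, hs, hV, hΛ⟩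
    choose X hX1 hX2 hX3 hX4 using fun m => (mem_wordType_iff Δ Λ).1 (hs m)
    simp only at hX2 hX3 hX4
    obtain ⟨x, hx, hxq⟩ := exists_concat hα X (fun m => by rw [hX4, hX2]) t.2.2
    have hVx : ∀ m : ℕ, {q | ∃ β < α, x (α * m + β) = q} = V m := by
      intro m
      rw [← hX3]
      ext q
      exact exists_congr fun β => and_congr_right fun hβ => by rw [hx m β hβ.le]
    refine ⟨x, (ordRun_mul_omega0_iff rfl hα _ _).2 ⟨fun m => (hX1 m).congr fun i hi =>
      (hx m i hi).symm, ?_⟩, ?_, ?_, hxq⟩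
    · rw [cofinalValues_mul_omega0 x hα, hxq]
      simpa only [← hVx, Set.mem_ofPred_eq] using hΛ
    · rw [← h0, ← hX2, ← hx 0 0 zero_le]
      simp
    · rw [hV, himage]
      simp only [← hVx, Set.mem_ofPred_eq]

/-- Treats letters as blocks of length one, which makes `ω`-words an instance of
`wordType_mul_omega0`. -/
theorem wordType_one (u : OrdWord S 1) :
    wordType Δ Λ u = {t : Q × Set Q × Q | (t.1, u ⟨0, Set.mem_Iio.2 one_pos⟩, t.2.2) ∈ Δ ∧
      t.2.1 = {t.1}} := by
  apply RunType.ext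
  intro t
  constructor
  · rintro ⟨x, hx, h0, hV, h1⟩
    have := hx.succ 0 one_pos
    refine ⟨?_, ?_⟩
    · rw [← h0, ← h1]
      simpa using this
    · rw [← hV, ← h0]
      ext q
      simp [Order.lt_one_iff, eq_comm]
  · rintro ⟨hΔ, hV⟩
    refine ⟨fun i => if i = 0 then t.1 else t.2.2, ⟨fun i hi => ?_, fun i hi hl => ?_⟩, by simp,
      ?_, by simp⟩
    · obtain rfl := Order.lt_one_iff.1 hi
      simpa using hΔ
    · exact absurd (Ordinal.omega0_le_of_isSuccLimit hl |>.trans hi)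
        (not_le.2 Ordinal.one_lt_omega0)
    · rw [hV]
      ext q
      simp [Order.lt_one_iff, eq_comm]

/-- The `ω`-words of a given type form a regular language. -/
theorem isRegularOrdLanguage_wordType_omega0 [Finite Q] (τ : RunType Q) :
    IsRegularOrdLanguage {u : OrdWord S ω | wordType Δ Λ u = τ} := by
  let f : S → RunType Q := fun a => {t : Q × Set Q × Q | (t.1, a, t.2.2) ∈ Δ ∧ t.2.1 = {t.1}}
  convert isRegularOrdLanguage_of_infiniteProd f (RunType.omegaProd Λ)
    (RunType.omegaProd_segmentProd Λ) {τ} using 1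
  ext u
  have : ∀ m : ℕ, wordType Δ Λ (u.natBlock (one_mul ω) m) =
      f (u ⟨m, Ordinal.natCast_lt_omega0 m⟩) := by
    intro m
    rw [wordType_one]
    simp [f, OrdWord.natBlock, OrdWord.block]
    rfl
  simp only [Set.mem_ofPred_eq, Set.mem_singleton_iff,
    wordType_mul_omega0 Δ Λ (one_mul ω) one_ne_zero u, this]

end WordType

theorem isSuccLimit_omega0_pow {k : ℕ} (hk : k ≠ 0) : IsSuccLimit (ω ^ k : Ordinal.{0}) := by
  obtain ⟨k, rfl⟩ := Nat.exists_eq_succ_of_ne_zero hk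
  rw [pow_succ]
  exact Ordinal.isSuccLimit_mul_right (pow_pos Ordinal.omega0_pos k) Ordinal.isSuccLimit_omega0

theorem cofinalValues_nonempty {Q : Type*} [Finite Q] (x : Ordinal.{0} → Q) {i : Ordinal.{0}}
    (hi : IsSuccLimit i) : (cofinalValues x i).Nonempty := by
  -- The constant map to a point has a cofinal value, which `cofinalValues_comp` lifts to `x`.
  have h : () ∈ cofinalValues (fun _ => ()) i := fun μ hμ =>
    ⟨succ μ, hi.succ_lt hμ, lt_succ μ, rfl⟩
  rw [cofinalValues_comp (fun _ => ()) x (by rintro rfl; simp at hi)] at h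
  exact Set.image_nonempty.1 ⟨_, h⟩

/-! ### Ranks of positions. -/

section Rank

variable {S : Type*} {α : Ordinal.{0}}

/-- Successor steps of ranks. -/
def rankSucc (S : Type*) : Set (ℕ × S × ℕ) := {t | t.2.2 = 0}

/-- Limit steps of ranks. -/
def rankLim : Set (Set ℕ × ℕ) := {t | t.2 = sSup t.1 + 1}

/-- The boundaries give the maximum `k`. The value at `0` is left free, since the first block does
not affect cofinality. -/
theorem sSup_cofinalValues_mul_omega0 (hα : α ≠ 0) {r : Ordinal.{0} → ℕ} {k : ℕ}
    (h1 : ∀ m : ℕ, ∀ β < α, β ≠ 0 → r (α * m + β) < k)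
    (h2 : ∀ m : ℕ, r (α * ((m + 1 : ℕ) : Ordinal.{0})) = k) :
    sSup (cofinalValues r (α * ω)) = k := by
  rw [cofinalValues_mul_omega0 r hα]
  refine IsGreatest.csSup_eq ⟨?_, ?_⟩
  · rw [Set.mem_ofPred_eq, frequently_atTop]
    exact fun a => ⟨a + 1, Nat.le_succ a, 0, pos_iff_ne_zero.2 hα, by rw [add_zero, h2]⟩
  · intro q hq
    obtain ⟨m, hm, β, hβ, rfl⟩ := frequently_atTop.1 hq 1
    by_cases hb : β = 0
    · obtain ⟨m, rfl⟩ := Nat.exists_eq_add_of_le' hm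
      rw [hb, add_zero, h2]
    · exact (h1 m β hβ hb).le

/-- On a word of length `ω ^ k` the ranks are less than `k` at the inner positions and `k` at the
end. -/
theorem rank_lt_and_eq (k : ℕ) (u : OrdWord S (ω ^ k)) (r : Ordinal.{0} → ℕ)
    (hr : OrdRun (rankSucc S) rankLim u r) :
    (∀ i < ω ^ k, i ≠ 0 → r i < k) ∧ r (ω ^ k) = k := by
  induction k generalizing r with
  | zero =>
    rw [pow_zero] at *
    refine ⟨fun i hi h0 => absurd (Order.lt_one_iff.1 hi) h0, ?_⟩
    have : r (succ 0) = 0 := hr.succ 0 (by simp)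
    simpa using this
  | succ k ih =>
    have hα : (ω ^ k : Ordinal.{0}) ≠ 0 := pow_ne_zero _ Ordinal.omega0_ne_zero
    have h : (ω ^ k * ω : Ordinal.{0}) = ω ^ (k + 1) := (pow_succ _ _).symm
    rw [ordRun_mul_omega0_iff h hα] at hr
    have hb := fun m => ih _ _ (hr.1 m)
    have hend : ∀ m : ℕ, r (ω ^ k * ((m + 1 : ℕ) : Ordinal.{0})) = k := by
      intro m
      rw [← mul_natCast_add_self]
      exact (hb m).2
    refine ⟨fun i hi h0 => ?_, ?_⟩
    · rw [← h] at hi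
      obtain ⟨m, β, hβ, hβ0, rfl⟩ := exists_eq_mul_add_pos_of_lt_mul_omega0 hα hi h0
      rcases hβ.lt_or_eq with hlt | rfl
      · exact Nat.lt_succ_of_lt ((hb m).1 β hlt hβ0)
      · exact Nat.lt_succ_of_le (hb m).2.le
    · have hlim : r (ω ^ (k + 1)) = sSup (cofinalValues r (ω ^ (k + 1))) + 1 := hr.2
      rw [← h] at hlim ⊢
      rw [hlim, sSup_cofinalValues_mul_omega0 hα (fun m β hβ h0 => (hb m).1 β hβ h0) hend]

open Classical in
/-- The rank of an ordinal: `0` for successors, one more than the supremum of the ranks that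
appear cofinally below for limits. -/
noncomputable def ordRank (i : Ordinal.{0}) : ℕ :=
  if IsSuccLimit i then sSup {q | ∀ μ < i, ∃ ν, ∃ _ : ν < i, μ < ν ∧ ordRank ν = q} + 1 else 0
termination_by i

/-- Valid at every length: on unbounded sets of ranks `sSup` takes the same default value in
`ordRank` and in `rankLim`. -/
theorem ordRun_ordRank (u : OrdWord S α) : OrdRun (rankSucc S) rankLim u ordRank where
  succ i hi := by
    change ordRank (succ i) = 0
    rw [ordRank, if_neg (not_isSuccLimit_succ i)]
  lim i hi hl := by
    change ordRank i = _
    rw [ordRank, if_pos hl]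
    simp only [cofinalValues, exists_prop]

end Rank

/-! ### Closure of regular languages under substitution. -/

section Substitution

/-- States of the automaton for a substitution of languages of words of length `ω ^ k`: the rank of
the position, the letter whose language contains the present block, states of the automata for
the letters, of which only the one for `letter` matters, and a state of the outer automaton. -/
structure SubstState (k : ℕ) (Γ : Type) (Q : Γ → Type) (P : Type) where
  /-- the rank of the position -/
  rank : Fin (k + 2)
  /-- the letter whose language contains the present block -/
  letter : Γ
  /-- states of the automata for the letters -/
  inner : ∀ a, Q a
  /-- the state of the outer automaton at the beginning of the present block -/
  outer : P

instance {k : ℕ} {Γ : Type} {Q : Γ → Type} {P : Type} [Finite Γ] [∀ a, Finite (Q a)] [Finite P] :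
    Finite (SubstState k Γ Q P) :=
  Finite.of_injective
    (fun s => ((s.rank, s.letter, s.inner, s.outer) : Fin (k + 2) × Γ × (∀ a, Q a) × P))
    (by rintro ⟨⟩ ⟨⟩ h; simpa using h)

variable {S : Type*} {k : ℕ} {Γ : Type} {Q : Γ → Type} {P : Type}
  (M : ∀ a, OrdBuchi S (Q a)) (N : OrdBuchi Γ P)

/-- Successor steps of the automaton for a substitution. -/
def substSucc (k : ℕ) (P : Type) : Set (SubstState k Γ Q P × S × SubstState k Γ Q P) :=
  {t | (t.1.inner t.1.letter, t.2.1, t.2.2.inner t.1.letter) ∈ (M t.1.letter).succStep ∧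
    t.2.2.rank = 0 ∧ t.2.2.letter = t.1.letter ∧ t.2.2.outer = t.1.outer}

/-- Limit steps of the automaton for a substitution: inside a block, between two blocks and at the
end of the word. -/
def substLim (k : ℕ) : Set (Set (SubstState k Γ Q P) × SubstState k Γ Q P) :=
  {t | (t.2.rank : ℕ) = sSup ((fun s => (s.rank : ℕ)) '' t.1) + 1 ∧
    (((t.2.rank : ℕ) < k ∧ ∃ s ∈ t.1, t.2.letter = s.letter ∧ t.2.outer = s.outer ∧
        ((fun s' => s'.inner s.letter) '' t.1, t.2.inner s.letter) ∈ (M s.letter).limStep) ∨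
      -- The state `q` that ends the inner run is guessed and not stored: the state at the boundary
      -- already holds the start of the next block.
      ((t.2.rank : ℕ) = k ∧ ∃ s ∈ t.1, ∃ q ∈ (M s.letter).accept,
        ((fun s' => s'.inner s.letter) '' t.1, q) ∈ (M s.letter).limStep ∧
        (s.outer, s.letter, t.2.outer) ∈ N.succStep ∧
        t.2.inner t.2.letter = (M t.2.letter).init) ∨
      ((t.2.rank : ℕ) = k + 1 ∧
        ((fun s => s.outer) '' {s ∈ t.1 | (s.rank : ℕ) = k}, t.2.outer) ∈ N.limStep))}

variable {M N} [Finite Γ] [∀ a, Finite (Q a)] [Finite P]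

/-- With `rank_lt_and_eq` this forces the stored rank away from position `0`, so the position
decides which kind of limit step is taken. -/
theorem ordRun_rank_of_ordRun_subst {α : Ordinal.{0}} {u : OrdWord S α}
    {x : Ordinal.{0} → SubstState k Γ Q P}
    (hx : OrdRun (substSucc M k P) (substLim M N k) u x) :
    OrdRun (rankSucc S) rankLim u (fun i => ((x i).rank : ℕ)) where
  succ i hi := by
    have := (hx.succ i hi).2.1
    simp only at this
    change ((x (succ i)).rank : ℕ) = 0
    rw [this]
    rfl
  lim i hi hl := by
    change ((x i).rank : ℕ) = _
    rw [cofinalValues_comp (fun s => (s.rank : ℕ)) x (by rintro rfl; simp at hl)]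
    exact (hx.lim i hi hl).1

/-- Inside the block the rank stays below `k`, so only inner limit steps occur and `letter` and
`outer` never change; at the end the rank is `k`, which forces the step between blocks. -/
theorem ordRun_subst_block {u : OrdWord S (ω ^ k)} (hk : k ≠ 0)
    {x : Ordinal.{0} → SubstState k Γ Q P}
    (hx : OrdRun (substSucc M k P) (substLim M N k) u x)
    (h0 : (x 0).inner (x 0).letter = (M (x 0).letter).init) :
    u ∈ (M (x 0).letter).language (ω ^ k) ∧
      ((x 0).outer, (x 0).letter, (x (ω ^ k)).outer) ∈ N.succStep ∧
      (x (ω ^ k)).inner (x (ω ^ k)).letter = (M (x (ω ^ k)).letter).init := by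
  classical
  obtain ⟨hrank, hrank'⟩ := rank_lt_and_eq k u _ (ordRun_rank_of_ordRun_subst hx)
  have hlim := isSuccLimit_omega0_pow hk
  have hinner : ∀ i < ω ^ k, IsSuccLimit i → ∃ s ∈ cofinalValues x i, (x i).letter = s.letter ∧
      (x i).outer = s.outer ∧ ((fun s' => s'.inner s.letter) '' cofinalValues x i,
        (x i).inner s.letter) ∈ (M s.letter).limStep := by
    intro i hi hl
    have hr := hrank i hi (by rintro rfl; simp at hl)
    rcases (hx.lim i hi.le hl).2 with h | h | h
    · exact h.2
    · exact absurd h.1 hr.ne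
    · exact absurd h.1 (by simp only at hr ⊢; omega)
  have hconst : ∀ i < ω ^ k, (x i).letter = (x 0).letter ∧ (x i).outer = (x 0).outer := by
    intro i
    induction i using WellFoundedLT.induction with
    | ind i ih =>
      intro hi
      rcases Ordinal.zero_or_succ_or_isSuccLimit i with rfl | ⟨c, rfl⟩ | hl
      · exact ⟨rfl, rfl⟩
      · have hc := (lt_succ c).trans hi
        obtain ⟨-, -, h1, h2⟩ := hx.succ c hc
        obtain ⟨h3, h4⟩ := ih c (lt_succ c) hc
        exact ⟨h1.trans h3, h2.trans h4⟩
      · obtain ⟨s, hs, h1, h2, -⟩ := hinner i hi hl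
        obtain ⟨ν, hν, -, rfl⟩ := hs 0 (pos_iff_ne_zero.2 (by rintro rfl; simp at hl))
        obtain ⟨h3, h4⟩ := ih ν hν (hν.trans hi)
        exact ⟨h1.trans h3, h2.trans h4⟩
  have hcof : ∀ i ≤ ω ^ k, i ≠ 0 → ∀ s ∈ cofinalValues x i,
      s.letter = (x 0).letter ∧ s.outer = (x 0).outer := by
    intro i hi hi0 s hs
    obtain ⟨ν, hν, -, rfl⟩ := hs 0 (pos_iff_ne_zero.2 hi0)
    exact hconst ν (hν.trans_le hi)
  have hend : ∃ s ∈ cofinalValues x (ω ^ k), ∃ q ∈ (M s.letter).accept,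
      ((fun s' => s'.inner s.letter) '' cofinalValues x (ω ^ k), q) ∈ (M s.letter).limStep ∧
      (s.outer, s.letter, (x (ω ^ k)).outer) ∈ N.succStep ∧
      (x (ω ^ k)).inner (x (ω ^ k)).letter = (M (x (ω ^ k)).letter).init := by
    rcases (hx.lim _ le_rfl hlim).2 with h | h | h
    · exact absurd h.1 hrank'.ge.not_gt
    · exact h.2
    · exact absurd h.1 (by simp only at hrank' ⊢; omega)
  obtain ⟨s, hs, q, hq, hql, hN, hinit⟩ := hend
  obtain ⟨hsl, hso⟩ := hcof _ le_rfl hlim.bot_lt.ne' s hs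
  rw [hsl] at hN
  rw [hso] at hN
  refine ⟨?_, hN, hinit⟩
  obtain ⟨rk, a, z, b⟩ := s
  simp only at hsl hso hq hql
  subst hsl
  rw [OrdBuchi.mem_language_iff]
  -- The final value is the guessed accepting state `q`, because `x (ω ^ k)` belongs to the next
  -- block.
  let y : Ordinal.{0} → Q (x 0).letter := fun i =>
    if i < ω ^ k then (x i).inner (x 0).letter else q
  have hy : ∀ i < ω ^ k, y i = (x i).inner (x 0).letter := fun i hi => if_pos hi
  have hyend : y (ω ^ k) = q := if_neg (lt_irrefl _)
  have hycof : ∀ i ≤ ω ^ k, i ≠ 0 →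
      cofinalValues y i = (fun s' => s'.inner (x 0).letter) '' cofinalValues x i := by
    intro i hi hi0
    rw [← cofinalValues_comp _ x hi0]
    exact cofinalValues_congr fun ν hν => hy ν (hν.trans_le hi)
  refine ⟨y, ⟨fun i hi => ?_, fun i hi hl => ?_⟩, ?_, by rwa [hyend]⟩
  · have h1 := (hx.succ i hi).1
    simp only at h1
    rw [(hconst i hi).1] at h1
    rwa [hy i hi, hy _ (hlim.succ_lt hi)]
  · have hi0 : i ≠ 0 := by rintro rfl; simp at hl
    rw [hycof i hi hi0]
    rcases hi.lt_or_eq with hi' | rfl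
    · obtain ⟨s, hs, h1, h2, h3⟩ := hinner i hi' hl
      rw [(hcof i hi hi0 s hs).1] at h3
      rwa [hy i hi']
    · rwa [hyend]
  · rw [hy 0 hlim.bot_lt, h0]

theorem exists_ordRun_subst_block {u : OrdWord S (ω ^ k)} (hk : k ≠ 0)
    (s s' : SubstState k Γ Q P) (hs' : (s'.rank : ℕ) = k)
    (hinit : s.inner s.letter = (M s.letter).init)
    (hinit' : s'.inner s'.letter = (M s'.letter).init)
    (hu : u ∈ (M s.letter).language (ω ^ k))
    (hN : (s.outer, s.letter, s'.outer) ∈ N.succStep) :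
    ∃ x, OrdRun (substSucc M k P) (substLim M N k) u x ∧ x 0 = s ∧ x (ω ^ k) = s' := by
  classical
  obtain ⟨hrank, hrank'⟩ := rank_lt_and_eq k u _ (ordRun_ordRank u)
  have hrun := ordRun_ordRank u
  have hlim := isSuccLimit_omega0_pow hk
  rw [OrdBuchi.mem_language_iff] at hu
  obtain ⟨y, hy, hy0, hya⟩ := hu
  -- Ranks inside the block are below `k`, so `Fin.ofNat` does not reduce them. Only the component
  -- of `inner` at the current letter is simulated.
  let x : Ordinal.{0} → SubstState k Γ Q P := fun i =>
    if i = 0 then s else if i < ω ^ k then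
      ⟨Fin.ofNat (k + 2) (ordRank i), s.letter, Function.update s.inner s.letter (y i), s.outer⟩
    else s'
  have hx0 : x 0 = s := if_pos rfl
  have hxe : x (ω ^ k) = s' := by simp [x]
  have hxr : ∀ i ≤ ω ^ k, i ≠ 0 → ((x i).rank : ℕ) = ordRank i := by
    intro i hi hi0
    rcases hi.lt_or_eq with hlt | rfl
    · have := hrank i hlt hi0
      simp only [x, if_neg hi0, if_pos hlt, Fin.val_ofNat]
      exact Nat.mod_eq_of_lt (by omega)
    · rw [hxe, hs', hrank']
  have hxl : ∀ i < ω ^ k, (x i).letter = s.letter ∧ (x i).outer = s.outer ∧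
      (x i).inner s.letter = y i := by
    intro i hi
    by_cases hi0 : i = 0
    · rw [hi0, hx0, hinit, hy0]
      exact ⟨rfl, rfl, rfl⟩
    · simp [x, hi0, hi]
  -- The ranks of `x` and `ordRank` may differ at position `0`, which is harmless: a witness of
  -- cofinality can always be taken above `0`.
  have hcofr : ∀ i ≤ ω ^ k, i ≠ 0 →
      (fun s => (s.rank : ℕ)) '' cofinalValues x i = cofinalValues ordRank i := by
    intro i hi hi0
    rw [← cofinalValues_comp (fun s => (s.rank : ℕ)) x hi0]
    ext q
    constructor
    · intro h μ hμ
      obtain ⟨ν, hν, h1, h2⟩ := h μ hμ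
      exact ⟨ν, hν, h1, (hxr ν (hν.le.trans hi) (pos_of_gt h1).ne').symm.trans h2⟩
    · intro h μ hμ
      obtain ⟨ν, hν, h1, h2⟩ := h μ hμ
      exact ⟨ν, hν, h1, by simp only [hxr ν (hν.le.trans hi) (pos_of_gt h1).ne', h2]⟩
  have hcofy : ∀ i ≤ ω ^ k, i ≠ 0 →
      (fun s' => s'.inner s.letter) '' cofinalValues x i = cofinalValues y i := by
    intro i hi hi0
    rw [← cofinalValues_comp (fun s' => s'.inner s.letter) x hi0]
    exact cofinalValues_congr fun ν hν => (hxl ν (hν.trans_le hi)).2.2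
  have hne : ∀ i ≤ ω ^ k, IsSuccLimit i → ∃ t ∈ cofinalValues x i, t.letter = s.letter ∧
      t.outer = s.outer := by
    intro i hi hl
    have hi0 : i ≠ 0 := by rintro rfl; simp at hl
    obtain ⟨t, ht⟩ := cofinalValues_nonempty x hl
    obtain ⟨ν, hν, -, rfl⟩ := ht 0 (pos_iff_ne_zero.2 hi0)
    obtain ⟨h2, h3, -⟩ := hxl ν (hν.trans_le hi)
    exact ⟨_, ht, h2, h3⟩
  refine ⟨x, ⟨fun i hi => ?_, fun i hi hl => ?_⟩, hx0, hxe⟩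
  · obtain ⟨h1, h2, h3⟩ := hxl i hi
    obtain ⟨h1', h2', h3'⟩ := hxl _ (hlim.succ_lt hi)
    refine ⟨?_, ?_, h1'.trans h1.symm, h2'.trans h2.symm⟩
    · simp only
      rw [h1, h3, h3']
      exact hy.succ i hi
    · have hr : ordRank (succ i) = 0 := hrun.succ i hi
      apply Fin.ext
      rw [hxr _ (succ_le_of_lt hi) (by simp), hr]
      rfl
  · have hi0 : i ≠ 0 := by rintro rfl; simp at hl
    have hr : ordRank i = sSup (cofinalValues ordRank i) + 1 := hrun.lim i hi hl
    obtain ⟨t, ht, htl, hto⟩ := hne i hi hl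
    obtain ⟨rk, a, z, b⟩ := t
    simp only at htl hto
    subst htl hto
    refine ⟨?_, ?_⟩
    · simp only [hxr i hi hi0, hcofr i hi hi0, hr]
    · rcases hi.lt_or_eq with hlt | rfl
      · obtain ⟨h1, h2, h3⟩ := hxl i hlt
        refine Or.inl ⟨?_, _, ht, h1, h2, ?_⟩
        · simp only [hxr i hi hi0, hrank i hlt hi0]
        · simp only [hcofy i hi hi0, h3]
          exact hy.lim i hi hl
      · refine Or.inr (Or.inl ⟨by rw [hxe, hs'], _, ht, y (ω ^ k), hya, ?_, ?_, ?_⟩)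
        · simp only [hcofy _ hi hi0]
          exact hy.lim _ hi hl
        · simp only [hxe]
          exact hN
        · simp only
          rw [hxe]
          exact hinit'


/-- Rank `k` filters out the inner positions, so what remains is the limit set of the outer run
sampled at block starts. -/
theorem outer_image_cofinalValues {α : Ordinal.{0}} (hα : α ≠ 0)
    {x : Ordinal.{0} → SubstState k Γ Q P}
    (h1 : ∀ m : ℕ, ∀ β < α, β ≠ 0 → ((x (α * m + β)).rank : ℕ) < k)
    (h2 : ∀ m : ℕ, ((x (α * m)).rank : ℕ) = k) :
    (fun s => s.outer) '' {s ∈ cofinalValues x (α * ω) | (s.rank : ℕ) = k} =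
      {b | ∃ᶠ m : ℕ in atTop, (x (α * m)).outer = b} := by
  rw [cofinalValues_mul_omega0 x hα]
  ext b
  constructor
  · rintro ⟨s, ⟨hs, hr⟩, rfl⟩
    refine Frequently.mono hs ?_
    rintro m ⟨β, hβ, rfl⟩
    by_cases hb : β = 0
    · rw [hb, add_zero]
    · exact absurd hr (h1 m β hβ hb).ne
  · intro hb
    have : ∃ᶠ m : ℕ in atTop, ∃ s : SubstState k Γ Q P, s.outer = b ∧ x (α * m) = s :=
      Frequently.mono hb fun m hm => ⟨_, hm, rfl⟩
    obtain ⟨s, hs⟩ := frequently_exists_iff_of_finite.1 this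
    obtain ⟨m, hm, rfl⟩ := hs.exists
    exact ⟨_, ⟨hs.mono fun n hn => ⟨0, pos_iff_ne_zero.2 hα, by rw [add_zero, hn.2]⟩, h2 m⟩, hm⟩

/-- Regular languages are closed under substitution. -/
theorem isRegularOrdLanguage_ordSubstitution {γ : Ordinal.{0}} (hk : k ≠ 0)
    (hγ : ω ^ k * ω = γ) {R : Set (OrdWord Γ ω)} {L : Γ → Set (OrdWord S (ω ^ k))}
    (hR : IsRegularOrdLanguage R) (hL : ∀ a, IsRegularOrdLanguage (L a)) :
    IsRegularOrdLanguage (ordSubstitution hγ R L) := by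
  obtain ⟨P, _, N, rfl⟩ := hR
  choose Q _ M hM using hL
  have hα : (ω ^ k : Ordinal.{0}) ≠ 0 := pow_ne_zero _ Ordinal.omega0_ne_zero
  have hγ' : ω ^ (k + 1) = γ := by rw [← hγ, pow_succ]
  convert isRegularOrdLanguage_of_initialSet (substSucc M k P) (substLim M N k)
    -- Position `0` is given rank `k`, so that it counts as a block boundary like the others.
    {s | (s.rank : ℕ) = k ∧ s.inner s.letter = (M s.letter).init ∧ s.outer = N.init}
    {s | s.outer ∈ N.accept} (α := γ) (by rw [← hγ]; simp [hα]) using 1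
  ext w
  constructor
  · rintro ⟨σ, hσ, hw⟩
    obtain ⟨y, q, hy0, hy, hyl, hq⟩ := (N.mem_language_omega0_iff σ).1 hσ
    let σ' : ℕ → Γ := fun m => σ ⟨m, Ordinal.natCast_lt_omega0 m⟩
    let s : ℕ → SubstState k Γ Q P := fun m =>
      ⟨Fin.ofNat (k + 2) k, σ' m, fun a => (M a).init, y m⟩
    have hsr : ∀ m, ((s m).rank : ℕ) = k := fun m => Nat.mod_eq_of_lt (by omega)
    have hblock : ∀ m, w.natBlock hγ m ∈ (M (σ' m)).language (ω ^ k) := fun m => by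
      rw [hM]
      exact hw ⟨m, Ordinal.natCast_lt_omega0 m⟩
    choose X hX hX0 hX1 using fun m => exists_ordRun_subst_block (N := N) hk (s m) (s (m + 1))
      (hsr (m + 1)) rfl rfl (hblock m) (hy m)
    obtain ⟨x, hx, hxe⟩ := exists_concat hα X (fun m => by rw [hX0, hX1])
      ⟨Fin.ofNat (k + 2) (k + 1), σ' 0, fun a => (M a).init, q⟩
    have hxs : ∀ m : ℕ, x (ω ^ k * m) = s m := by
      intro m
      rw [← hX0, ← hx m 0 zero_le, add_zero]
    have hrank : ∀ m : ℕ, ∀ β < ω ^ k, β ≠ 0 → ((x (ω ^ k * m + β)).rank : ℕ) < k := by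
      intro m β hβ hβ0
      rw [hx m β hβ.le]
      exact (rank_lt_and_eq k _ _ (ordRun_rank_of_ordRun_subst (hX m))).1 β hβ hβ0
    have hrank' : ∀ m : ℕ, ((x (ω ^ k * m)).rank : ℕ) = k := fun m => by rw [hxs, hsr]
    refine ⟨x, (ordRun_mul_omega0_iff hγ hα _ _).2 ⟨fun m => (hX m).congr fun i hi =>
      (hx m i hi).symm, ?_⟩, ?_, ?_⟩
    · rw [← hγ]
      refine ⟨?_, Or.inr (Or.inr ⟨?_, ?_⟩)⟩
      · simp only
        rw [← cofinalValues_comp (fun s => (s.rank : ℕ)) x (by simp [hα]),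
          sSup_cofinalValues_mul_omega0 hα hrank fun m => hrank' (m + 1), hxe]
        exact Nat.mod_eq_of_lt (by omega)
      · rw [hxe]
        exact Nat.mod_eq_of_lt (by omega)
      · simp only
        rw [outer_image_cofinalValues hα hrank hrank', hxe]
        simpa only [hxs] using hyl
    · have := hxs 0
      rw [Nat.cast_zero, mul_zero] at this
      rw [this]
      exact ⟨hsr 0, rfl, hy0⟩
    · rw [← hγ, hxe]
      exact hq
  · rintro ⟨x, hx, ⟨hr0, hi0, ho0⟩, hacc⟩
    -- Rank `k + 1` at the end leaves only the third kind of limit step there, that of the outer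
    -- automaton.
    have hrankend : ((x γ).rank : ℕ) = k + 1 := by
      subst hγ'
      exact (rank_lt_and_eq (k + 1) w _ (ordRun_rank_of_ordRun_subst hx)).2
    have hlim := hx.lim γ le_rfl (hγ' ▸ isSuccLimit_omega0_pow k.succ_ne_zero)
    rw [ordRun_mul_omega0_iff hγ hα] at hx
    have hrank := fun m => rank_lt_and_eq k _ _ (ordRun_rank_of_ordRun_subst (hx.1 m))
    have hrank' : ∀ m : ℕ, ((x (ω ^ k * m)).rank : ℕ) = k := by
      intro m
      cases m with
      | zero => rw [Nat.cast_zero, mul_zero, hr0]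
      | succ m =>
        rw [← mul_natCast_add_self]
        exact (hrank m).2
    have hinit : ∀ m : ℕ, (x (ω ^ k * m)).inner (x (ω ^ k * m)).letter =
        (M (x (ω ^ k * m)).letter).init := by
      intro m
      induction m with
      | zero => rw [Nat.cast_zero, mul_zero, hi0]
      | succ m ih =>
        have := (ordRun_subst_block hk (hx.1 m) (by rw [add_zero]; exact ih)).2.2
        rwa [mul_natCast_add_self] at this
    have hstep := fun m => ordRun_subst_block hk (hx.1 m) (by rw [add_zero]; exact hinit m)
    simp only [add_zero, mul_natCast_add_self] at hstep
    have hnat : ∀ i : Set.Iio ω, ∃ m : ℕ, i = ⟨m, Ordinal.natCast_lt_omega0 m⟩ := by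
      rintro ⟨i, hi⟩
      obtain ⟨m, rfl⟩ := Ordinal.lt_omega0.1 hi
      exact ⟨m, rfl⟩
    refine ⟨fun i => (x (ω ^ k * i)).letter, ?_, fun i => ?_⟩
    · rw [N.mem_language_omega0_iff]
      refine ⟨fun m => (x (ω ^ k * m)).outer, (x γ).outer, ?_, fun m => (hstep m).2.1, ?_, hacc⟩
      · simpa using ho0
      · rw [← outer_image_cofinalValues hα (fun m => (hrank m).1) hrank', hγ]
        rcases hlim.2 with h | h | h
        · exact absurd h.1 (by simp only; omega)
        · exact absurd h.1 (by simp only; omega)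
        · exact h.2
    · obtain ⟨m, rfl⟩ := hnat i
      rw [← hM]
      have hm := (hstep m).1
      rw [add_zero] at hm
      exact hm

end Substitution

/-! ### Languages defined by types. -/

section Recognition

variable {S : Type*} {Q : Type} (Δ : Set (Q × S × Q)) (Λ : Set (Set Q × Q))

/-- A language of words of length `α * ω` that is defined through word types is obtained by
substitution from the languages of the words of length `α` of a given type. -/
theorem setOf_wordType_mem_eq_ordSubstitution {α γ : Ordinal.{0}} (h : α * ω = γ) (hα : α ≠ 0)
    (A : Set (RunType Q)) :
    {w : OrdWord S γ | wordType Δ Λ w ∈ A} = ordSubstitution h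
      {σ : OrdWord (RunType Q) ω |
        RunType.omegaProd Λ (fun m : ℕ => σ ⟨m, Ordinal.natCast_lt_omega0 m⟩) ∈ A}
      (fun τ => {u : OrdWord S α | wordType Δ Λ u = τ}) := by
  ext w
  rw [Set.mem_ofPred_eq, wordType_mul_omega0 Δ Λ h hα]
  constructor
  · intro hw
    exact ⟨fun i => wordType Δ Λ (w.block h i), hw, fun i => rfl⟩
  · rintro ⟨σ, hσ, hw⟩
    have : (fun m => wordType Δ Λ (w.natBlock h m)) =
        fun m : ℕ => σ ⟨m, Ordinal.natCast_lt_omega0 m⟩ := funext fun m => hw _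
    rw [this]
    exact hσ

theorem isRegularOrdLanguage_omegaProd_mem [Finite Q] (A : Set (RunType Q)) :
    IsRegularOrdLanguage {σ : OrdWord (RunType Q) ω |
      RunType.omegaProd Λ (fun m : ℕ => σ ⟨m, Ordinal.natCast_lt_omega0 m⟩) ∈ A} :=
  isRegularOrdLanguage_of_infiniteProd id (RunType.omegaProd Λ)
    (RunType.omegaProd_segmentProd Λ) A

/-- The words of length `ω ^ k` of a given type form a regular language. -/
theorem isRegularOrdLanguage_wordType [Finite Q] {k : ℕ} (hk : 1 ≤ k) (τ : RunType Q) :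
    IsRegularOrdLanguage {u : OrdWord S (ω ^ k) | wordType Δ Λ u = τ} := by
  induction k, hk using Nat.le_induction generalizing τ with
  | base =>
    rw [pow_one]
    exact isRegularOrdLanguage_wordType_omega0 Δ Λ τ
  | succ k hk ih =>
    -- A word of length `ω ^ (k + 1)` has type `τ` when the types of its blocks have infinite
    -- product `τ`: a substitution of the languages covered by the induction hypothesis.
    have h := setOf_wordType_mem_eq_ordSubstitution (S := S) Δ Λ
      (pow_succ (ω : Ordinal.{0}) k).symm (pow_ne_zero _ Ordinal.omega0_ne_zero) {τ}
    simp only [Set.mem_singleton_iff] at h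
    rw [h]
    exact isRegularOrdLanguage_ordSubstitution (by omega) _
      (isRegularOrdLanguage_omegaProd_mem Λ {τ}) ih

end Recognition

theorem proposition4p3 {S : Type*} [Finite S] (n : ℕ) (hn : 2 ≤ n)
    (L : Set (OrdWord S (ω ^ n))) :
    (IsRegularOrdLanguage L ↔
      ∃ (Γ : Type) (_ : Finite Γ) (R : Set (OrdWord Γ ω)) (La : Γ → Set (OrdWord S (ω ^ (n - 1)))),
        IsRegularOrdLanguage R ∧ (∀ a, IsRegularOrdLanguage (La a)) ∧
          L = ordSubstitution (omega0_pow_pred_mul hn) R La) ∧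
    (IsRegularOrdLanguage L ↔
      ∃ (Γ : Type) (_ : Finite Γ) (R : Set (OrdWord Γ ω)) (La : Γ → Set (OrdWord S (ω ^ (n - 1)))),
        IsRegularOrdLanguage R ∧ (∀ a, IsRegularOrdLanguage (La a)) ∧
          (∀ a b, a ≠ b → Disjoint (La a) (La b)) ∧
          L = ordSubstitution (omega0_pow_pred_mul hn) R La) := by
  have hsubst : ∀ (Γ : Type) (_ : Finite Γ) (R : Set (OrdWord Γ ω))
      (La : Γ → Set (OrdWord S (ω ^ (n - 1)))), IsRegularOrdLanguage R →
      (∀ a, IsRegularOrdLanguage (La a)) →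
      L = ordSubstitution (omega0_pow_pred_mul hn) R La → IsRegularOrdLanguage L := by
    rintro Γ _ R La hR hLa rfl
    exact isRegularOrdLanguage_ordSubstitution (by omega) _ hR hLa
  have hdisj : IsRegularOrdLanguage L → ∃ (Γ : Type) (_ : Finite Γ) (R : Set (OrdWord Γ ω))
      (La : Γ → Set (OrdWord S (ω ^ (n - 1)))),
      IsRegularOrdLanguage R ∧ (∀ a, IsRegularOrdLanguage (La a)) ∧
        (∀ a b, a ≠ b → Disjoint (La a) (La b)) ∧
        L = ordSubstitution (omega0_pow_pred_mul hn) R La := by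
    rintro ⟨Q, _, M, rfl⟩
    -- `R` and `La` are read off from the two regularity statements: sequences of types whose
    -- infinite product contains an accepting triple, and words of a given type.
    refine ⟨RunType Q, inferInstance, _, _,
      isRegularOrdLanguage_omegaProd_mem M.limStep
        {τ | ∃ t ∈ τ, t.1 = M.init ∧ t.2.2 ∈ M.accept},
      isRegularOrdLanguage_wordType M.succStep M.limStep (by omega), ?_, ?_⟩
    · intro a b hab
      exact Set.disjoint_left.2 fun u ha hb => hab (ha.symm.trans hb)
    · rw [← setOf_wordType_mem_eq_ordSubstitution _ _ _ (pow_ne_zero _ Ordinal.omega0_ne_zero)]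
      ext w
      exact M.mem_language_iff_wordType w
  refine ⟨⟨fun h => ?_, ?_⟩, ⟨hdisj, ?_⟩⟩
  · obtain ⟨Γ, hΓ, R, La, hR, hLa, -, hL⟩ := hdisj h
    exact ⟨Γ, hΓ, R, La, hR, hLa, hL⟩
  · rintro ⟨Γ, hΓ, R, La, hR, hLa, hL⟩
    exact hsubst Γ hΓ R La hR hLa hL
  · rintro ⟨Γ, hΓ, R, La, hR, hLa, -, hL⟩
    exact hsubst Γ hΓ R La hR hLa hL
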